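/- All modules over rings below are finitely generated. Let $R$ be a commutative artinian ring, let $A$ and $B$ be Artin $R$-algebras, and let ${}_BM_A$ and ${}_AN_B$ be bimodules, finitely generated over $R$ and on which $R$ acts centrally, with $M\otimes_A N=0=N\otimes_B M$. Let $\Lambda=\begin{pmatrix}A&N\\M&B\end{pmatrix}$ be the Morita ring, with multiplication $$\begin{pmatrix}a&n\\m&b\end{pmatrix}\begin{pmatrix}a'&n'\\m'&b'\end{pmatrix}=\begin{pmatrix}aa'&an'+nb'\\ma'+bm'&bb'\end{pmatrix}$$ (the pairings $M\otimes_AN\to B$ and $N\otimes_BM\to A$ are necessarily zero). A left $\Lambda$-module is written $\begin{pmatrix}X\\Y\end{pmatrix}_{f,g}$, where $X$ is a left $A$-module, $Y$ a left $B$-module, $f:M\otimes_AX\to Y$ is $B$-linear, $g:N\otimes_BY\to X$ is $A$-linear, and the matrix above sends $\begin{pmatrix}x\\y\end{pmatrix}$ to $\begin{pmatrix}ax+g(n\otimes y)\\f(m\otimes x)+by\end{pmatrix}$. Similarly, $(M,0)_{0,0}$ is the right $\Lambda$-module $M$ on which the matrix above acts as $a$. A complete projective resolution over a ring $S$ (one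 of $A,B,\Lambda$) is an acyclic complex $P^\bullet$, indexed by $\mathbb Z$, of finitely generated projective left $S$-modules such that $\mathrm{Hom}_S(P^\bullet,Q)$ is acyclic for every finitely generated projective left $S$-module $Q$. A left $S$-module is Gorenstein-projective if it is isomorphic to $\mathrm{Ker}\,d^0$ for some such $P^\bullet$. The algebra $S$ is GP-free if every Gorenstein-projective left $S$-module is projective, and GP-finite if there are only finitely many isomorphism classes of indecomposable Gorenstein-projective left $S$-modules. A left $S$-module $L$ is Hom-compatible if $\mathrm{Hom}_S(P^\bullet,L)$ is acyclic for every complete projective resolution $P^\bullet$ over $S$; a right $S$-module $L$ is tensor-compatible if $L\otimes_SP^\bullet$ is acyclic for every such $P^\bullet$. A bimodule is compatible if it is Hom-compatible as a left module and tensor-compatible as a right module. Assume that ${}_BM_A$ and ${}_AN_B$ are compatible bimodules. Then: (1) If $\Lambda$ is GP-free, then so are $A$ and $B$. Conversely, if the right $\Lambda$-module $(M,0)_{0,0}$ is tensor-compatible, the left $\Lambda$-module $\begin{pmatrix}N\\0\end{pmatrix}_{0,0}$ is Hom-compatible, and $A$ and $B$ are GP-free, then $\Lambda$ is GP-free. (2)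 If $\Lambda$ is GP-finite, then so are $A$ and $B$. (3) Assume that $(M,0)_{0,0}$ is tensor-compatible, $\mathrm{gl.dim}\,B<\infty$ and $\mathrm{pd}\,{}_AN<\infty$. Then, up to isomorphism, the indecomposable Gorenstein-projective left $\Lambda$-modules are precisely the modules $$\begin{pmatrix}G\\M\otimes_AG\end{pmatrix}_{\mathrm{id},0}\quad\text{and}\quad\begin{pmatrix}N\otimes_BQ\\Q\end{pmatrix}_{0,\mathrm{id}},$$ where $G$ runs over the indecomposable Gorenstein-projective left $A$-modules and $Q$ over the indecomposable projective left $B$-modules. (4) Assume that $(M,0)_{0,0}$ is tensor-compatible, $\begin{pmatrix}N\\0\end{pmatrix}_{0,0}$ is Hom-compatible, $\mathrm{gl.dim}\,A<\infty$ and $\mathrm{pd}\,{}_BM<\infty$. Then, up to isomorphism, the indecomposable Gorenstein-projective left $\Lambda$-modules are precisely the modules $$\begin{pmatrix}P\\M\otimes_AP\end{pmatrix}_{\mathrm{id},0}\quad\text{and}\quad\begin{pmatrix}N\otimes_BE\\E\end{pmatrix}_{0,\mathrm{id}},$$ where $P$ runs over the indecomposable projective left $A$-modules and $E$ over the indecomposable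 Gorenstein-projective left $B$-modules. -/

import Mathlib

open CategoryTheory

universe u

noncomputable section

/-! ## Tensor products over a noncommutative ring

A right module over `A` is a left module over `Aᵐᵒᵖ`; `x · a` is `MulOpposite.op a • x`. -/

section NCTensor

open TensorProduct

/-- The subgroup of `M ⊗[ℤ] X` generated by the elements `(m · a) ⊗ x - m ⊗ (a • x)`. -/
def balancedRel (A M X : Type*) [Ring A] [AddCommGroup M] [Module Aᵐᵒᵖ M]
    [AddCommGroup X] [Module A X] : AddSubgroup (M ⊗[ℤ] X) :=
  AddSubgroup.closure
    {t | ∃ (m : M) (a : A) (x : X), t = (MulOpposite.op a • m) ⊗ₜ[ℤ] x - m ⊗ₜ[ℤ] (a • x)}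

/-- The tensor product `M ⊗_A X` of a right `A`-module `M` and a left `A`-module `X`,
an abelian group. -/
def NCTensor (A M X : Type*) [Ring A] [AddCommGroup M] [Module Aᵐᵒᵖ M]
    [AddCommGroup X] [Module A X] : Type _ :=
  (M ⊗[ℤ] X) ⧸ balancedRel A M X

namespace NCTensor

variable {A M X : Type*} [Ring A] [AddCommGroup M] [Module Aᵐᵒᵖ M]
    [AddCommGroup X] [Module A X]

instance : AddCommGroup (NCTensor A M X) :=
  inferInstanceAs (AddCommGroup ((M ⊗[ℤ] X) ⧸ balancedRel A M X))

variable (A M X) in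
/-- The quotient map. -/
def mk : (M ⊗[ℤ] X) →+ NCTensor A M X :=
  QuotientAddGroup.mk' (balancedRel A M X)

theorem mk_surjective : Function.Surjective (mk A M X) :=
  QuotientAddGroup.mk'_surjective (balancedRel A M X)

variable (A) in
/-- The pure tensor `m ⊗ x`. -/
def tmul (m : M) (x : X) : NCTensor A M X :=
  mk A M X (m ⊗ₜ[ℤ] x)

theorem add_tmul (m m' : M) (x : X) : tmul A (m + m') x = tmul A m x + tmul A m' x := by
  simp [tmul, TensorProduct.add_tmul]

theorem tmul_add (m : M) (x x' : X) : tmul A m (x + x') = tmul A m x + tmul A m x' := by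
  simp [tmul, TensorProduct.tmul_add]

theorem smul_tmul (m : M) (a : A) (x : X) :
    tmul A (MulOpposite.op a • m) x = tmul A m (a • x) := by
  refine (QuotientAddGroup.eq_iff_sub_mem).2 ?_
  exact AddSubgroup.subset_closure ⟨m, a, x, rfl⟩

theorem zero_tmul (x : X) : tmul A (0 : M) x = 0 := by
  simp [tmul, TensorProduct.zero_tmul]

theorem tmul_zero (m : M) : tmul A m (0 : X) = 0 := by
  simp [tmul, TensorProduct.tmul_zero]

theorem induction {p : NCTensor A M X → Prop} (h0 : p 0) (ht : ∀ m x, p (tmul A m x))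
    (ha : ∀ s t, p s → p t → p (s + t)) (t : NCTensor A M X) : p t := by
  obtain ⟨t, rfl⟩ := mk_surjective t
  induction t using TensorProduct.induction_on with
  | zero => rw [map_zero]; exact h0
  | tmul m x => exact ht m x
  | add s t hs ht' => rw [map_add]; exact ha _ _ hs ht'

/-- Two additive maps that agree on the pure tensors are equal. -/
theorem hom_ext {G : Type*} [AddCommGroup G] {f g : NCTensor A M X →+ G}
    (h : ∀ m x, f (tmul A m x) = g (tmul A m x)) : f = g := by
  ext t
  induction t using NCTensor.induction with
  | h0 => simp
  | ht m x => exact h m x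
  | ha s t hs ht => simp [hs, ht]

/-- The universal property: a biadditive balanced map `M × X → G` gives `M ⊗_A X → G`. -/
def lift {G : Type*} [AddCommGroup G] (φ : M →+ X →+ G)
    (h : ∀ (m : M) (a : A) (x : X), φ (MulOpposite.op a • m) x = φ m (a • x)) :
    NCTensor A M X →+ G :=
  QuotientAddGroup.lift (balancedRel A M X)
    (TensorProduct.liftAddHom φ (fun r m x => by simp)) <| by
      rw [balancedRel, AddSubgroup.closure_le]
      rintro _ ⟨m, a, x, rfl⟩
      simp [h]

@[simp] theorem lift_tmul {G : Type*} [AddCommGroup G] (φ : M →+ X →+ G)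
    (h : ∀ (m : M) (a : A) (x : X), φ (MulOpposite.op a • m) x = φ m (a • x)) (m : M) (x : X) :
    lift φ h (tmul A m x) = φ m x := rfl

/-- `tmul` as a biadditive map. -/
def mkHom : M →+ X →+ NCTensor A M X :=
  AddMonoidHom.mk' (fun m => AddMonoidHom.mk' (fun x => tmul A m x) (tmul_add m))
    (fun m m' => by ext x; exact add_tmul m m' x)

@[simp] theorem mkHom_apply (m : M) (x : X) : mkHom m x = tmul A m x := rfl

variable (M) in
/-- The map `1 ⊗ h : M ⊗_A X → M ⊗_A X'` induced by an `A`-linear map `h : X → X'`. -/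
def map {X' : Type*} [AddCommGroup X'] [Module A X'] (h : X →ₗ[A] X') :
    NCTensor A M X →+ NCTensor A M X' :=
  lift ((AddMonoidHom.compHom' h.toAddMonoidHom).comp mkHom)
    (fun m a x => by simp [smul_tmul])

@[simp] theorem map_tmul {X' : Type*} [AddCommGroup X'] [Module A X'] (h : X →ₗ[A] X')
    (m : M) (x : X) : map M h (tmul A m x) = tmul A m (h x) := rfl

section LeftAction

variable {B : Type*} [Ring B] [Module B M] [SMulCommClass B Aᵐᵒᵖ M]

/-- The action of `b : B` on `M ⊗_A X`, for a `B`-`A`-bimodule `M`. -/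
def act (b : B) : NCTensor A M X →+ NCTensor A M X :=
  lift (mkHom.comp (DistribSMul.toAddMonoidHom M b))
    (fun m a x => by simp [smul_comm b (MulOpposite.op a) m, smul_tmul])

theorem act_tmul (b : B) (m : M) (x : X) :
    act b (tmul A m x) = tmul A (b • m) x := rfl

/-- If `M` is a `B`-`A`-bimodule, then `M ⊗_A X` is a left `B`-module, by
`b • (m ⊗ x) = (b • m) ⊗ x`. -/
instance : Module B (NCTensor A M X) where
  smul b t := act b t
  one_smul t := DFunLike.congr_fun
    (hom_ext (f := act (1 : B)) (g := AddMonoidHom.id _) fun m x => by simp [act_tmul]) t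
  mul_smul b c t := DFunLike.congr_fun
    (hom_ext (f := act (b * c)) (g := (act b).comp (act c))
      fun m x => by simp [act_tmul, mul_smul]) t
  smul_zero b := map_zero (act b)
  smul_add b := map_add (act b)
  add_smul b c t := DFunLike.congr_fun
    (hom_ext (f := act (b + c)) (g := act b + act c)
      fun m x => by simp [act_tmul, add_smul, add_tmul]) t
  zero_smul t := DFunLike.congr_fun
    (hom_ext (f := act (0 : B)) (g := 0) fun m x => by simp [act_tmul, zero_tmul]) t

theorem smul_tmul' (b : B) (m : M) (x : X) :
    b • tmul A m x = tmul A (b • m) x := rfl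

end LeftAction

end NCTensor

end NCTensor

/-! ## Complete projective resolutions and Gorenstein-projective modules

All complexes consist of finitely generated modules. -/

section Gorenstein

variable (S : Type u) [Ring S]

/-- A sequence of `S`-modules `⋯ → X i → X (i + 1) → ⋯` indexed by `ℤ`. -/
structure ModSeq where
  X : ℤ → ModuleCat.{u} S
  d : ∀ i, X i →ₗ[S] X (i + 1)

variable {S}

namespace ModSeq

/-- The sequence is an acyclic complex. -/
def Acyclic (P : ModSeq S) : Prop :=
  ∀ i, Function.Exact (P.d i) (P.d (i + 1))

/-- The complex `Hom_S(P, L)` is acyclic. -/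
def HomAcyclic (P : ModSeq S) (L : ModuleCat.{u} S) : Prop :=
  ∀ i, Function.Exact
    (fun φ : P.X (i + 1 + 1) →ₗ[S] L => φ ∘ₗ P.d (i + 1))
    (fun φ : P.X (i + 1) →ₗ[S] L => φ ∘ₗ P.d i)

/-- The complex `L ⊗_S P` is acyclic, for a right `S`-module `L`. -/
def TensorAcyclic (P : ModSeq S) (L : ModuleCat.{u} Sᵐᵒᵖ) : Prop :=
  ∀ i, Function.Exact (NCTensor.map L (P.d i)) (NCTensor.map L (P.d (i + 1)))

/-- A complete projective resolution in the category of finitely generated `S`-modules: an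
acyclic complex `P` of finitely generated projective modules such that `Hom_S(P, Q)` is acyclic
for every finitely generated projective module `Q`. -/
structure IsCompleteProjectiveResolution (P : ModSeq S) : Prop where
  finite : ∀ i, Module.Finite S (P.X i)
  projective : ∀ i, Module.Projective S (P.X i)
  acyclic : P.Acyclic
  homAcyclic : ∀ Q : ModuleCat.{u} S, Module.Finite S Q → Module.Projective S Q → P.HomAcyclic Q

end ModSeq

/-- `G` is a (finitely generated) Gorenstein-projective module: it is isomorphic to the kernel of
the differential `d 0` of a complete projective resolution. -/
def IsGorensteinProjective (G : ModuleCat.{u} S) : Prop :=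
  ∃ P : ModSeq S, P.IsCompleteProjectiveResolution ∧ Nonempty (G ≃ₗ[S] LinearMap.ker (P.d 0))

/-- A left module `L` is Hom-compatible if `Hom_S(P, L)` is acyclic for each complete projective
resolution `P`. -/
def IsHomCompatible (L : ModuleCat.{u} S) : Prop :=
  ∀ P : ModSeq S, P.IsCompleteProjectiveResolution → P.HomAcyclic L

/-- A right module `L` is tensor-compatible if `L ⊗_S P` is acyclic for each complete projective
resolution `P` of left modules. -/
def IsTensorCompatible (L : ModuleCat.{u} Sᵐᵒᵖ) : Prop :=
  ∀ P : ModSeq S, P.IsCompleteProjectiveResolution → P.TensorAcyclic L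

variable (S)

/-- Every Gorenstein-projective module is projective. -/
def IsGPFree : Prop :=
  ∀ G : ModuleCat.{u} S, IsGorensteinProjective G → Module.Projective S G

/-- There are only finitely many isomorphism classes of indecomposable Gorenstein-projective
modules. -/
def IsGPFinite : Prop :=
  ∃ F : Finset (ModuleCat.{u} S), ∀ G : ModuleCat.{u} S,
    Indecomposable G → IsGorensteinProjective G → ∃ H ∈ F, Nonempty (G ≅ H)

/-- The (left) global dimension: the supremum of the projective dimensions of the finitely
generated modules. -/
def globalDimension : WithBot ℕ∞ :=
  ⨆ (X : ModuleCat.{u} S) (_ : Module.Finite S X), projectiveDimension X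

/-- An `A`-`B`-bimodule `L` is compatible if it is Hom-compatible as a left `A`-module and
tensor-compatible as a right `B`-module. -/
def IsCompatibleBimodule (A B L : Type u) [Ring A] [Ring B] [AddCommGroup L] [Module A L]
    [Module Bᵐᵒᵖ L] [SMulCommClass A Bᵐᵒᵖ L] : Prop :=
  IsHomCompatible (ModuleCat.of A L) ∧ IsTensorCompatible (ModuleCat.of Bᵐᵒᵖ L)

end Gorenstein

/-! ## Morita rings

If `M ⊗_A N = 0 = N ⊗_B M`, then the structure maps `M ⊗_A N → B` and `N ⊗_B M → A` of a Morita
ring vanish, and the ring is the following one. -/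

/-- The `2 × 2` matrices with first row `(a, n)` and second row `(m, b)`. -/
@[ext] structure MoritaRing (A N M B : Type u) where
  a : A
  n : N
  m : M
  b : B

set_option linter.unusedSectionVars false

namespace MoritaRing

open MulOpposite

variable {A N M B : Type u} [Ring A] [Ring B]
  [AddCommGroup M] [Module B M] [Module Aᵐᵒᵖ M] [SMulCommClass B Aᵐᵒᵖ M]
  [AddCommGroup N] [Module A N] [Module Bᵐᵒᵖ N] [SMulCommClass A Bᵐᵒᵖ N]

instance : Zero (MoritaRing A N M B) := ⟨⟨0, 0, 0, 0⟩⟩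
instance : Add (MoritaRing A N M B) := ⟨fun x y => ⟨x.a + y.a, x.n + y.n, x.m + y.m, x.b + y.b⟩⟩
instance : Neg (MoritaRing A N M B) := ⟨fun x => ⟨-x.a, -x.n, -x.m, -x.b⟩⟩
instance : One (MoritaRing A N M B) := ⟨⟨1, 0, 0, 1⟩⟩
/-- Matrix multiplication, with zero pairings between `M` and `N`. -/
instance : Mul (MoritaRing A N M B) :=
  ⟨fun x y => ⟨x.a * y.a, x.a • y.n + op y.b • x.n, op y.a • x.m + x.b • y.m, x.b * y.b⟩⟩

@[simp] theorem zero_a : (0 : MoritaRing A N M B).a = 0 := rfl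
@[simp] theorem zero_n : (0 : MoritaRing A N M B).n = 0 := rfl
@[simp] theorem zero_m : (0 : MoritaRing A N M B).m = 0 := rfl
@[simp] theorem zero_b : (0 : MoritaRing A N M B).b = 0 := rfl
@[simp] theorem one_a : (1 : MoritaRing A N M B).a = 1 := rfl
@[simp] theorem one_n : (1 : MoritaRing A N M B).n = 0 := rfl
@[simp] theorem one_m : (1 : MoritaRing A N M B).m = 0 := rfl
@[simp] theorem one_b : (1 : MoritaRing A N M B).b = 1 := rfl

section

variable (x y : MoritaRing A N M B)

@[simp] theorem add_a : (x + y).a = x.a + y.a := rfl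
@[simp] theorem add_n : (x + y).n = x.n + y.n := rfl
@[simp] theorem add_m : (x + y).m = x.m + y.m := rfl
@[simp] theorem add_b : (x + y).b = x.b + y.b := rfl
@[simp] theorem neg_a : (-x).a = -x.a := rfl
@[simp] theorem neg_n : (-x).n = -x.n := rfl
@[simp] theorem neg_m : (-x).m = -x.m := rfl
@[simp] theorem neg_b : (-x).b = -x.b := rfl
@[simp] theorem mul_a : (x * y).a = x.a * y.a := rfl
@[simp] theorem mul_n : (x * y).n = x.a • y.n + op y.b • x.n := rfl
@[simp] theorem mul_m : (x * y).m = op y.a • x.m + x.b • y.m := rfl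
@[simp] theorem mul_b : (x * y).b = x.b * y.b := rfl

end

instance : Ring (MoritaRing A N M B) where
  add_assoc x y z := by ext <;> simp [add_assoc]
  zero_add x := by ext <;> simp
  add_zero x := by ext <;> simp
  add_comm x y := by ext <;> simp [add_comm]
  neg_add_cancel x := by ext <;> simp
  mul_assoc x y z := by
    ext
    · simp [mul_assoc]
    · simp [mul_smul, smul_add, add_assoc, smul_comm]
    · simp [mul_smul, smul_add, add_assoc, smul_comm]
    · simp [mul_assoc]
  one_mul x := by ext <;> simp
  mul_one x := by ext <;> simp
  zero_mul x := by ext <;> simp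
  mul_zero x := by ext <;> simp
  left_distrib x y z := by
    ext
    · simp [mul_add]
    · simp [smul_add, add_smul]; abel
    · simp [smul_add, add_smul]; abel
    · simp [mul_add]
  right_distrib x y z := by
    ext
    · simp [add_mul]
    · simp [smul_add, add_smul]; abel
    · simp [smul_add, add_smul]; abel
    · simp [add_mul]
  nsmul := nsmulRec
  zsmul := zsmulRec

open NCTensor in
/-- The left module `(X, Y)ᵗ` with structure maps `f : M ⊗_A X → Y` and `g : N ⊗_B Y → X`: the
matrix with rows `(a, n)` and `(m, b)` sends the column `(x, y)` to
`(a x + g (n ⊗ y), f (m ⊗ x) + b y)`. -/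
abbrev leftColumnModule (X : ModuleCat.{u} A) (Y : ModuleCat.{u} B)
    (f : NCTensor A M X →ₗ[B] Y) (g : NCTensor B N Y →ₗ[A] X)
    (hgf : ∀ (n : N) (m : M) (x : X), g (tmul B n (f (tmul A m x))) = 0)
    (hfg : ∀ (m : M) (n : N) (y : Y), f (tmul A m (g (tmul B n y))) = 0) :
    Module (MoritaRing A N M B) (X × Y) where
  smul r p := (r.a • p.1 + g (tmul B r.n p.2), f (tmul A r.m p.1) + r.b • p.2)
  one_smul p := by
    change ((1 : A) • p.1 + g (tmul B (0 : N) p.2), f (tmul A (0 : M) p.1) + (1 : B) • p.2) = p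
    simp [zero_tmul]
  mul_smul r s p := by
    change ((r * s).a • p.1 + g (tmul B (r * s).n p.2), f (tmul A (r * s).m p.1) + (r * s).b • p.2)
      = (r.a • (s.a • p.1 + g (tmul B s.n p.2)) + g (tmul B r.n (f (tmul A s.m p.1) + s.b • p.2)),
        f (tmul A r.m (s.a • p.1 + g (tmul B s.n p.2))) + r.b • (f (tmul A s.m p.1) + s.b • p.2))
    ext
    · simp only [mul_a, mul_n, add_tmul, tmul_add, map_add, hgf, smul_tmul, ← smul_tmul',
        map_smul, mul_smul, smul_add, zero_add]
      abel
    · simp only [mul_b, mul_m, add_tmul, tmul_add, map_add, hfg, smul_tmul, ← smul_tmul',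
        map_smul, mul_smul, smul_add, add_zero]
      abel
  smul_zero r := by
    change (r.a • (0 : X) + g (tmul B r.n (0 : Y)), f (tmul A r.m (0 : X)) + r.b • (0 : Y)) = 0
    simp [tmul_zero]
  smul_add r p q := by
    change (r.a • (p.1 + q.1) + g (tmul B r.n (p.2 + q.2)),
        f (tmul A r.m (p.1 + q.1)) + r.b • (p.2 + q.2))
      = (r.a • p.1 + g (tmul B r.n p.2), f (tmul A r.m p.1) + r.b • p.2)
        + (r.a • q.1 + g (tmul B r.n q.2), f (tmul A r.m q.1) + r.b • q.2)
    ext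
    · simp only [tmul_add, map_add, smul_add, Prod.fst_add]; abel
    · simp only [tmul_add, map_add, smul_add, Prod.snd_add]; abel
  add_smul r s p := by
    change ((r.a + s.a) • p.1 + g (tmul B (r.n + s.n) p.2),
        f (tmul A (r.m + s.m) p.1) + (r.b + s.b) • p.2)
      = (r.a • p.1 + g (tmul B r.n p.2), f (tmul A r.m p.1) + r.b • p.2)
        + (s.a • p.1 + g (tmul B s.n p.2), f (tmul A s.m p.1) + s.b • p.2)
    ext
    · simp only [add_tmul, map_add, add_smul, Prod.fst_add]; abel
    · simp only [add_tmul, map_add, add_smul, Prod.snd_add]; abel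
  zero_smul p := by
    change ((0 : A) • p.1 + g (tmul B (0 : N) p.2), f (tmul A (0 : M) p.1) + (0 : B) • p.2) = 0
    simp [zero_tmul]

open NCTensor in
/-- The left module `(X, Y)ᵗ` with structure maps `f` and `g`, as an object of the category of
left modules. -/
def leftColumn (X : ModuleCat.{u} A) (Y : ModuleCat.{u} B)
    (f : NCTensor A M X →ₗ[B] Y) (g : NCTensor B N Y →ₗ[A] X)
    (hgf : ∀ (n : N) (m : M) (x : X), g (tmul B n (f (tmul A m x))) = 0)
    (hfg : ∀ (m : M) (n : N) (y : Y), f (tmul A m (g (tmul B n y))) = 0) :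
    ModuleCat.{u} (MoritaRing A N M B) :=
  @ModuleCat.of (MoritaRing A N M B) _ (X × Y) _ (leftColumnModule X Y f g hgf hfg)

variable (N M)

/-- The left module `(X, M ⊗_A X)ᵗ` with structure maps `id` and `0`. -/
def inducedA (X : ModuleCat.{u} A) : ModuleCat.{u} (MoritaRing A N M B) :=
  leftColumn X (ModuleCat.of B (NCTensor A M X)) LinearMap.id 0
    (fun _ _ _ => rfl) (fun m _ _ => NCTensor.tmul_zero m)

/-- The left module `(N ⊗_B Y, Y)ᵗ` with structure maps `0` and `id`. -/
def inducedB (Y : ModuleCat.{u} B) : ModuleCat.{u} (MoritaRing A N M B) :=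
  leftColumn (ModuleCat.of A (NCTensor B N Y)) Y 0 LinearMap.id
    (fun n _ _ => NCTensor.tmul_zero n) (fun _ _ _ => rfl)

/-- The left module `(X, 0)ᵗ` with structure maps `0` and `0`. -/
def columnA (X : ModuleCat.{u} A) : ModuleCat.{u} (MoritaRing A N M B) :=
  leftColumn X (ModuleCat.of B PUnit.{u + 1}) 0 0 (fun _ _ _ => rfl) (fun _ _ _ => rfl)

variable (A B) in
/-- The projection of the matrix ring (with zero pairings) to the entry `a`. -/
def projA : MoritaRing A N M B →+* A where
  toFun := MoritaRing.a
  map_one' := rfl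
  map_mul' _ _ := rfl
  map_zero' := rfl
  map_add' _ _ := rfl

/-- The right module `(X, 0)` with structure maps `0` and `0`, for a right `A`-module `X`:
the matrix with rows `(a, n)` and `(m, b)` sends the row `(x, 0)` to `(x a, 0)`; that is,
the matrix ring acts on `X` through its entry `a`. -/
def rowA (X : ModuleCat.{u} Aᵐᵒᵖ) : ModuleCat.{u} (MoritaRing A N M B)ᵐᵒᵖ :=
  (ModuleCat.restrictScalars (RingHom.op (projA A N M B))).obj X

end MoritaRing

end

/-! Let `L` be the Morita ring, with diagonal idempotents e_A and e_B. The functor T_A X = (X, M ⊗_A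
X) (`Induced`) is left adjoint to the exact functor Z ↦ e_A Z (`corner`), so it preserves
projectives. For a finitely generated projective Q, e_A Q is a summand of some (A × N)ⁿ. Hence, if M
is tensor-compatible and N is Hom-compatible over A, T_A sends complete projective resolutions to
complete projective resolutions, and Gorenstein-projectives to Gorenstein-projectives. Since e_A T_A
X ≅ X and T_A X is generated by X, T_A also preserves and reflects indecomposability; X is moreover
a retract of A ⊗_L T_A X, so projectivity is reflected. This gives the descent from Λ to A and B in
(1) and (2).

Conversely, every L-module Z has an exact sequence N ⊗_L Z → e_A Z → A ⊗_L Z → 0, where N ⊗_L Z = N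
⊗_B (B ⊗_L Z), and its mirror image. The first map is injective when Z is finitely generated
projective, so for a complete resolution P acyclicity of N ⊗_L P gives that of A ⊗_L P. The
sequences 0 → M ⊗_A X → T_A X → X → 0 give the matching statement for Hom. The row hypothesis makes
B ⊗_L P acyclic; the column hypothesis, or finite global dimension of B, makes it complete;
compatibility of M and N over B then makes A ⊗_L P complete (`isDiagComplete_of_compatible`,
`isDiagComplete_of_globalDimension`).

Let Z be a cocycle module of P with B ⊗_L Z projective. The sequence ending in B ⊗_L Z splits. The
one ending in A ⊗_L Z splits too: its kernel N ⊗_B (B ⊗_L Z) is a summand of some Nⁿ, and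
Hom-compatibility of N kills the extensions of the Gorenstein-projective A ⊗_L Z by it. So Z ≅ T_A(A
⊗_L Z) ⊕ T_B(B ⊗_L Z) (`nonempty_ker_equiv`). If A and B are GP-free, Z is projective; if B has
finite global dimension, an indecomposable Z is one of the two summands. Part (4) is the case with A
and B exchanged. -/

noncomputable section

set_option linter.unusedSectionVars false

/-! ## Further properties of the tensor product -/

namespace NCTensor

section

variable {A M X Y Z : Type*} [Ring A] [AddCommGroup M] [Module Aᵐᵒᵖ M]
  [AddCommGroup X] [Module A X] [AddCommGroup Y] [Module A Y] [AddCommGroup Z] [Module A Z]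

theorem map_id_apply (t : NCTensor A M X) : map M (LinearMap.id : X →ₗ[A] X) t = t :=
  DFunLike.congr_fun (hom_ext (f := map M (LinearMap.id : X →ₗ[A] X)) (g := AddMonoidHom.id _)
    fun m x => by simp) t

theorem map_comp_apply (g : Y →ₗ[A] Z) (f : X →ₗ[A] Y) (t : NCTensor A M X) :
    map M (g ∘ₗ f) t = map M g (map M f t) :=
  DFunLike.congr_fun (hom_ext (f := map M (g ∘ₗ f)) (g := (map M g).comp (map M f))
    fun m x => by simp) t

theorem map_zero_apply (t : NCTensor A M X) : map M (0 : X →ₗ[A] Y) t = 0 :=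
  DFunLike.congr_fun (hom_ext (f := map M (0 : X →ₗ[A] Y)) (g := 0)
    fun m x => by simp [tmul_zero]) t

theorem map_add_apply (f g : X →ₗ[A] Y) (t : NCTensor A M X) :
    map M (f + g) t = map M f t + map M g t :=
  DFunLike.congr_fun (hom_ext (f := map M (f + g)) (g := map M f + map M g)
    fun m x => by simp [tmul_add]) t

theorem map_surjective {f : X →ₗ[A] Y} (hf : Function.Surjective f) :
    Function.Surjective (map M f) := fun t => by
  induction t using NCTensor.induction with
  | h0 => exact ⟨0, map_zero _⟩
  | ht m y =>
    obtain ⟨x, rfl⟩ := hf y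
    exact ⟨tmul A m x, by simp⟩
  | ha s t hs ht =>
    obtain ⟨s, rfl⟩ := hs
    obtain ⟨t, rfl⟩ := ht
    exact ⟨s + t, map_add _ _ _⟩

end

/-! ### Linear structure on tensor products; tensoring with kernels and with projectives. -/

section Linear

variable (K : Type*) {A M X Y Z G : Type*} [Ring A] [Ring K] [AddCommGroup M] [Module Aᵐᵒᵖ M]
  [Module K M] [SMulCommClass K Aᵐᵒᵖ M] [AddCommGroup X] [Module A X] [AddCommGroup Y] [Module A Y]
  [AddCommGroup Z] [Module A Z] [AddCommGroup G] [Module K G]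

/-- The universal property for maps that are linear in the first argument. -/
def liftLinear (f : M → X → G) (add_left : ∀ m m' x, f (m + m') x = f m x + f m' x)
    (add_right : ∀ m x x', f m (x + x') = f m x + f m x')
    (balanced : ∀ m (a : A) x, f (MulOpposite.op a • m) x = f m (a • x))
    (smul_left : ∀ (k : K) m x, f (k • m) x = k • f m x) : NCTensor A M X →ₗ[K] G where
  toFun := lift (AddMonoidHom.mk' (fun m => AddMonoidHom.mk' (f m) (add_right m))
    (fun m m' => by ext x; exact add_left m m' x)) balanced
  map_add' := map_add _
  map_smul' k t := by
    induction t using NCTensor.induction with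
    | h0 => simp
    | ht m x => exact smul_left k m x
    | ha s t hs ht => simp only [smul_add, map_add] at hs ht ⊢; rw [hs, ht]

variable {K}

/-- Two linear maps that agree on the pure tensors are equal. -/
theorem linear_ext {f g : NCTensor A M X →ₗ[K] G}
    (h : ∀ m x, f (tmul A m x) = g (tmul A m x)) : f = g := by
  have := hom_ext (f := f.toAddMonoidHom) (g := g.toAddMonoidHom) h
  ext t
  exact DFunLike.congr_fun this t

variable (K M)

/-- The map `1 ⊗ h` as a linear map. -/
def mapLinear (h : X →ₗ[A] Y) : NCTensor A M X →ₗ[K] NCTensor A M Y where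
  toFun := map M h
  map_add' := map_add _
  map_smul' k t := by
    induction t using NCTensor.induction with
    | h0 => simp
    | ht m x => simp [smul_tmul']
    | ha s t hs ht => simp only [smul_add, map_add] at hs ht ⊢; rw [hs, ht]

@[simp] theorem mapLinear_apply (h : X →ₗ[A] Y) (t : NCTensor A M X) :
    mapLinear K M h t = map M h t := rfl

/-- The comparison map `M ⊗ Ker h → Ker (1 ⊗ h)`. -/
def kerComparison (h : X →ₗ[A] Y) :
    NCTensor A M (LinearMap.ker h) →ₗ[K] LinearMap.ker (mapLinear K M h) :=
  (mapLinear K M (LinearMap.ker h).subtype).codRestrict _ fun t => by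
    rw [LinearMap.mem_ker, mapLinear_apply, mapLinear_apply, ← map_comp_apply,
      LinearMap.comp_ker_subtype, map_zero_apply]

/-- Since X maps onto Ker h, an element killed in M ⊗ Y lifts to M ⊗ X, is there a boundary from M ⊗
W, and W → X → Ker h is zero. -/
theorem map_subtype_ker_injective {W : Type*} [AddCommGroup W] [Module A W] {f : W →ₗ[A] X}
    {g : X →ₗ[A] Y} {h : Y →ₗ[A] Z} (hf : ∀ w, g (f w) = 0) (hg : Function.Exact g h)
    (hM : Function.Exact (map M f) (map M g)) :
    Function.Injective (map M (LinearMap.ker h).subtype) := by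
  rw [injective_iff_map_eq_zero]
  intro t ht
  let g' : X →ₗ[A] LinearMap.ker h := g.codRestrict _ fun x => hg.apply_apply_eq_zero x
  have hg' : Function.Surjective g' := fun y => by
    obtain ⟨x, hx⟩ := (hg y.1).1 y.2
    exact ⟨x, Subtype.ext hx⟩
  obtain ⟨s, rfl⟩ := map_surjective (M := M) hg' t
  rw [← map_comp_apply] at ht
  obtain ⟨w, rfl⟩ := (hM s).1 ht
  rw [← map_comp_apply, show g' ∘ₗ f = 0 from LinearMap.ext fun w => Subtype.ext (hf w),
    map_zero_apply]

/-- Exactness of the tensored complex at M ⊗ X gives injectivity; exactness at M ⊗ Y lets a cocycle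
come from M ⊗ X, hence from M ⊗ Ker h. -/
theorem kerComparison_bijective {W : Type*} [AddCommGroup W] [Module A W] {f : W →ₗ[A] X}
    {g : X →ₗ[A] Y} {h : Y →ₗ[A] Z} (hf : ∀ w, g (f w) = 0) (hg : Function.Exact g h)
    (hM : Function.Exact (map M f) (map M g)) (hM' : Function.Exact (map M g) (map M h)) :
    Function.Bijective (kerComparison K M h) := by
  refine ⟨fun s t hst => map_subtype_ker_injective M hf hg hM (congrArg Subtype.val hst), ?_⟩
  rintro ⟨y, hy⟩
  obtain ⟨x, rfl⟩ := (hM' y).1 hy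
  let g' : X →ₗ[A] LinearMap.ker h := g.codRestrict _ fun x => hg.apply_apply_eq_zero x
  exact ⟨map M g' x, Subtype.ext (map_comp_apply (LinearMap.ker h).subtype g' x).symm⟩

variable {n : ℕ}

/-- The map `M ⊗ X → Mⁿ` induced by a map `X → Aⁿ`. -/
def toPi (φ : X →ₗ[A] (Fin n → A)) : NCTensor A M X →ₗ[K] (Fin n → M) :=
  liftLinear K (fun m x j => MulOpposite.op (φ x j) • m)
    (fun m m' x => by ext j; simp) (fun m x x' => by ext j; simp [add_smul])
    (fun m a x => by ext j; simp [mul_smul])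
    (fun k m x => by ext j; simp [smul_comm])

/-- The map `Mⁿ → M ⊗ X` induced by a map `Aⁿ → X`. -/
def ofPi (ψ : (Fin n → A) →ₗ[A] X) : (Fin n → M) →ₗ[K] NCTensor A M X where
  toFun v := ∑ j, tmul A (v j) (ψ (Pi.single j 1))
  map_add' v w := by simp [add_tmul, Finset.sum_add_distrib]
  map_smul' k v := by simp [← smul_tmul', Finset.smul_sum]

/-- A dual basis computation: Σ m·φⱼ(x) ⊗ ψ(eⱼ) = m ⊗ Σ φⱼ(x) ψ(eⱼ) = m ⊗ x. -/
theorem ofPi_toPi {φ : X →ₗ[A] (Fin n → A)} {ψ : (Fin n → A) →ₗ[A] X}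
    (h : ψ ∘ₗ φ = LinearMap.id) : ofPi K M ψ ∘ₗ toPi K M φ = LinearMap.id := by
  refine linear_ext fun m x => ?_
  have hx : ∑ j, φ x j • ψ (Pi.single j 1) = x := by
    conv_rhs => rw [← LinearMap.id_apply (R := A) x, ← h, LinearMap.comp_apply,
      LinearMap.pi_apply_eq_sum_univ]
    refine Finset.sum_congr rfl fun j _ => ?_
    congr 2
    ext i
    simp [Pi.single_apply, eq_comm]
  change ∑ j, tmul A (MulOpposite.op (φ x j) • m) (ψ (Pi.single j 1)) = tmul A m x
  simp_rw [smul_tmul]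
  conv_rhs => rw [← hx]
  exact (map_sum (mkHom (A := A) (X := X) m) _ _).symm

/-- If `X` is finitely generated projective, then `M ⊗ X` is a direct summand of some `Mⁿ`. -/
theorem exists_retract [Module.Finite A X] [Module.Projective A X] :
    ∃ (n : ℕ) (i : NCTensor A M X →ₗ[K] (Fin n → M)) (r : (Fin n → M) →ₗ[K] NCTensor A M X),
      r ∘ₗ i = LinearMap.id := by
  obtain ⟨n, ψ, φ, -, -, h⟩ := Module.Finite.exists_comp_eq_id_of_projective A X
  exact ⟨n, toPi K M φ, ofPi K M ψ, ofPi_toPi K M h⟩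

end Linear

end NCTensor

/-! ## Acyclic sequences of modules -/

section ModSeqLemmas

variable {S : Type u} [Ring S]

namespace ModSeq

variable {P : ModSeq S} {L L' : Type u} [AddCommGroup L] [Module S L] [AddCommGroup L']
  [Module S L']

theorem Acyclic.d_comp_d (h : P.Acyclic) (i : ℤ) : P.d (i + 1) ∘ₗ P.d i = 0 :=
  (h i).linearMap_comp_eq_zero

/-- The other half of exactness is d ∘ d = 0, so only the extension of cocycles remains to be
checked. -/
theorem homAcyclic_iff (h : P.Acyclic) : P.HomAcyclic (ModuleCat.of S L) ↔
    ∀ i (φ : P.X (i + 1) →ₗ[S] L), φ ∘ₗ P.d i = 0 →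
      ∃ ψ : P.X (i + 1 + 1) →ₗ[S] L, ψ ∘ₗ P.d (i + 1) = φ := by
  refine ⟨fun H i φ hφ => (H i φ).1 hφ, fun H i φ => ⟨H i φ, ?_⟩⟩
  rintro ⟨ψ, rfl⟩
  change (ψ ∘ₗ P.d (i + 1)) ∘ₗ P.d i = 0
  rw [LinearMap.comp_assoc, h.d_comp_d, LinearMap.comp_zero]

theorem HomAcyclic.of_retract (h : P.Acyclic) (H : P.HomAcyclic (ModuleCat.of S L'))
    (ι : L →ₗ[S] L') (ρ : L' →ₗ[S] L) (hρ : ρ ∘ₗ ι = LinearMap.id) :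
    P.HomAcyclic (ModuleCat.of S L) := by
  rw [homAcyclic_iff h] at H ⊢
  intro i φ hφ
  obtain ⟨ψ, hψ⟩ := H i (ι ∘ₗ φ) (by rw [LinearMap.comp_assoc, hφ, LinearMap.comp_zero])
  exact ⟨ρ ∘ₗ ψ, by rw [LinearMap.comp_assoc, hψ, ← LinearMap.comp_assoc, hρ, LinearMap.id_comp]⟩

theorem HomAcyclic.pi (h : P.Acyclic) (H : P.HomAcyclic (ModuleCat.of S L)) (n : ℕ) :
    P.HomAcyclic (ModuleCat.of S (Fin n → L)) := by
  rw [homAcyclic_iff h] at H ⊢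
  intro i φ hφ
  choose ψ hψ using fun j : Fin n => H i (LinearMap.proj j ∘ₗ φ)
    (by rw [LinearMap.comp_assoc, hφ, LinearMap.comp_zero])
  exact ⟨LinearMap.pi ψ, LinearMap.ext fun x => funext fun j => LinearMap.congr_fun (hψ j) x⟩

theorem HomAcyclic.prod (h : P.Acyclic) (H : P.HomAcyclic (ModuleCat.of S L))
    (H' : P.HomAcyclic (ModuleCat.of S L')) : P.HomAcyclic (ModuleCat.of S (L × L')) := by
  rw [homAcyclic_iff h] at H H' ⊢
  intro i φ hφ
  obtain ⟨ψ, hψ⟩ := H i (LinearMap.fst S L L' ∘ₗ φ)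
    (by rw [LinearMap.comp_assoc, hφ, LinearMap.comp_zero])
  obtain ⟨ψ', hψ'⟩ := H' i (LinearMap.snd S L L' ∘ₗ φ)
    (by rw [LinearMap.comp_assoc, hφ, LinearMap.comp_zero])
  exact ⟨ψ.prod ψ', LinearMap.ext fun x =>
    Prod.ext (LinearMap.congr_fun hψ x) (LinearMap.congr_fun hψ' x)⟩

/-- M ⊗ X is a retract of Mⁿ, and Hom-acyclicity passes to finite powers and retracts. -/
theorem HomAcyclic.tensor {A M X : Type u} [Ring A] [AddCommGroup M] [Module Aᵐᵒᵖ M] [Module S M]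
    [SMulCommClass S Aᵐᵒᵖ M] [AddCommGroup X] [Module A X] [Module.Finite A X]
    [Module.Projective A X] (h : P.Acyclic) (H : P.HomAcyclic (ModuleCat.of S M)) :
    P.HomAcyclic (ModuleCat.of S (NCTensor A M X)) := by
  obtain ⟨n, ι, ρ, hρ⟩ := NCTensor.exists_retract (A := A) S M (X := X)
  exact (H.pi h n).of_retract h ι ρ hρ

/-- The surjection `P (i - 1) → Ker (d i)`. -/
def toKer (h : P.Acyclic) (i : ℤ) : P.X i →ₗ[S] LinearMap.ker (P.d (i + 1)) :=
  (P.d i).codRestrict _ fun x => (h i).apply_apply_eq_zero x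

theorem toKer_surjective (h : P.Acyclic) (i : ℤ) : Function.Surjective (toKer h i) := fun y => by
  obtain ⟨x, hx⟩ := (h i y.1).1 y.2
  exact ⟨x, Subtype.ext hx⟩

theorem finite_ker (h : P.Acyclic) (hf : ∀ i, Module.Finite S (P.X i)) (i : ℤ) :
    Module.Finite S (LinearMap.ker (P.d i)) := by
  obtain ⟨j, rfl⟩ : ∃ j, i = j + 1 := ⟨i - 1, by ring⟩
  have := hf j
  exact Module.Finite.of_surjective _ (toKer_surjective h j)

/-- Projective cocycle modules split every surjection onto them, so the complex is contractible. -/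
theorem exists_homotopy (h : P.Acyclic) (hk : ∀ i, Module.Projective S (LinearMap.ker (P.d i)))
    (i : ℤ) : ∃ (s : P.X (i + 1) →ₗ[S] P.X i) (t : P.X (i + 1 + 1) →ₗ[S] P.X (i + 1)),
      P.d i ∘ₗ s + t ∘ₗ P.d (i + 1) = LinearMap.id := by
  have hσ : ∀ j, ∃ σ : LinearMap.ker (P.d (j + 1)) →ₗ[S] P.X j, toKer h j ∘ₗ σ = LinearMap.id :=
    fun j => have := hk (j + 1); (toKer h j).exists_rightInverse_of_surjective
      (LinearMap.range_eq_top.2 (toKer_surjective h j))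
  choose σ hσ using hσ
  have hσ' : ∀ j y, P.d j (σ j y) = y.1 := fun j y => congrArg Subtype.val
    (LinearMap.congr_fun (hσ j) y)
  -- `r j` is the projection onto the cocycles along the image of `σ (j + 1)`.
  let r : ∀ j, P.X (j + 1) →ₗ[S] LinearMap.ker (P.d (j + 1)) := fun j =>
    (LinearMap.id - σ (j + 1) ∘ₗ toKer h (j + 1)).codRestrict _ fun x => by
      change P.d (j + 1) (x - σ (j + 1) (toKer h (j + 1) x)) = 0
      rw [map_sub, hσ', sub_eq_zero]
      rfl
  -- The contraction projects to the cocycles and lifts them back one degree; `s` and `t` are two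
  -- consecutive components of it.
  refine ⟨σ i ∘ₗ r i, σ (i + 1) ∘ₗ r (i + 1), LinearMap.ext fun x => ?_⟩
  have hr : r (i + 1) (P.d (i + 1) x) = toKer h (i + 1) x := by
    refine Subtype.ext ?_
    change P.d (i + 1) x - σ (i + 1 + 1) (toKer h (i + 1 + 1) (P.d (i + 1) x)) = P.d (i + 1) x
    rw [show toKer h (i + 1 + 1) (P.d (i + 1) x) = 0 from
      Subtype.ext ((h (i + 1)).apply_apply_eq_zero x), map_zero, sub_zero]
  simp only [LinearMap.add_apply, LinearMap.comp_apply, hσ', hr, LinearMap.id_apply]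
  change x - σ (i + 1) (toKer h (i + 1) x) + _ = x
  abel

/-- Every additive functor preserves a contracting homotopy; the same argument gives the tensor
version below. -/
theorem homAcyclic_of_projective_ker (h : P.Acyclic)
    (hk : ∀ i, Module.Projective S (LinearMap.ker (P.d i))) :
    P.HomAcyclic (ModuleCat.of S L) := by
  rw [homAcyclic_iff h]
  intro i φ hφ
  obtain ⟨s, t, hst⟩ := exists_homotopy h hk i
  refine ⟨φ ∘ₗ t, ?_⟩
  conv_rhs => rw [← φ.comp_id, ← hst, LinearMap.comp_add, ← LinearMap.comp_assoc, hφ,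
    LinearMap.zero_comp, zero_add, ← LinearMap.comp_assoc]

theorem tensorAcyclic_of_projective_ker (h : P.Acyclic)
    (hk : ∀ i, Module.Projective S (LinearMap.ker (P.d i))) (V : ModuleCat.{u} Sᵐᵒᵖ) :
    P.TensorAcyclic V := by
  intro i t
  obtain ⟨s, s', hs⟩ := exists_homotopy h hk i
  constructor
  · intro ht
    refine ⟨NCTensor.map V s t, ?_⟩
    conv_rhs => rw [← NCTensor.map_id_apply t, ← hs, NCTensor.map_add_apply,
      NCTensor.map_comp_apply, NCTensor.map_comp_apply, ht, map_zero, add_zero]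
  · rintro ⟨t, rfl⟩
    rw [← NCTensor.map_comp_apply, h.d_comp_d, NCTensor.map_zero_apply]

/-- Dimension shifting along 0 → Ker dⁱ → Pⁱ → Ker dⁱ⁺¹ → 0, whose middle term is projective. -/
theorem hasProjectiveDimensionLT_ker (h : P.Acyclic) (hp : ∀ i, Module.Projective S (P.X i))
    (i : ℤ) (n : ℕ) (H : HasProjectiveDimensionLT
      (ModuleCat.of S (LinearMap.ker (P.d (i + 1)))) (n + 2)) :
    HasProjectiveDimensionLT (ModuleCat.of S (LinearMap.ker (P.d i))) (n + 1) := by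
  let T : ShortComplex (ModuleCat.{u} S) := ShortComplex.mk
    (ModuleCat.ofHom (LinearMap.ker (P.d i)).subtype) (ModuleCat.ofHom (toKer h i))
    (ModuleCat.hom_ext (LinearMap.ext fun x => Subtype.ext x.2))
  have hT : T.ShortExact :=
    { exact := (ShortComplex.ShortExact.moduleCat_exact_iff_function_exact T).2 fun x =>
        ⟨fun hx => ⟨⟨x, congrArg Subtype.val hx⟩, rfl⟩, by
          rintro ⟨y, rfl⟩
          exact Subtype.ext y.2⟩
      mono_f := (ModuleCat.mono_iff_injective _).2 Subtype.val_injective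
      epi_g := (ModuleCat.epi_iff_surjective _).2 (toKer_surjective h i) }
  have := hp i
  have : Projective T.X₂ := (IsProjective.iff_projective (P.X i)).1 this
  exact hT.hasProjectiveDimensionLT_X₁ (n + 1) inferInstance H

/-- Each cocycle module is an n-th syzygy of the one n places to the right, whose projective
dimension is at most n. -/
theorem projective_ker_of_globalDimension (h : P.Acyclic) (hf : ∀ i, Module.Finite S (P.X i))
    (hp : ∀ i, Module.Projective S (P.X i)) (hS : globalDimension S < ⊤) (i : ℤ) :
    Module.Projective S (LinearMap.ker (P.d i)) := by
  obtain ⟨n, hn⟩ : ∃ n : ℕ, globalDimension S ≤ n := by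
    generalize globalDimension S = d at hS
    induction d with
    | bot => exact ⟨0, bot_le⟩
    | coe d =>
      induction d with
      | top => exact absurd hS (lt_irrefl _)
      | coe d => exact ⟨d, le_rfl⟩
  -- The bound pd ≤ n - k is proved for all degrees at once, because the induction step for degree
  -- `i` uses degree `i + 1`. At k = n it says projective.
  have H : ∀ (k : ℕ), k ≤ n → ∀ i, HasProjectiveDimensionLT
      (ModuleCat.of S (LinearMap.ker (P.d i))) (n - k + 1) := by
    intro k
    induction k with
    | zero =>
      intro _ i
      have := finite_ker h hf i
      refine (projectiveDimension_le_iff _ n).1 (le_trans ?_ hn)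
      exact le_iSup₂_of_le (ModuleCat.of S (LinearMap.ker (P.d i))) this le_rfl
    | succ k ih =>
      intro hk i
      have := ih (by omega) (i + 1)
      rw [show n - k + 1 = n - (k + 1) + 2 by omega] at this
      exact hasProjectiveDimensionLT_ker h hp i _ this
  have := H n le_rfl i
  rw [Nat.sub_self, zero_add, ← projective_iff_hasProjectiveDimensionLT_one] at this
  exact (IsProjective.iff_projective _).2 this

/-- If `Hom(P, Ker π)` is acyclic, then a surjection `π` onto a cocycle module of `P` splits. -/
theorem exists_section (h : P.Acyclic) (hp : ∀ i, Module.Projective S (P.X i)) (i : ℤ)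
    (π : L →ₗ[S] LinearMap.ker (P.d i)) (hπ : Function.Surjective π)
    (H : P.HomAcyclic (ModuleCat.of S (LinearMap.ker π))) :
    ∃ s : LinearMap.ker (P.d i) →ₗ[S] L, π ∘ₗ s = LinearMap.id := by
  -- The argument uses the stretch P_j → P_{j+1} → P_{j+2} → Ker d_{j+3}.
  obtain ⟨j, rfl⟩ : ∃ j, i = j + 1 + 1 + 1 := ⟨i - 3, by ring⟩
  have := hp (j + 1 + 1)
  obtain ⟨f, hf⟩ := Module.projective_lifting_property π (toKer h (j + 1 + 1)) hπ
  have hd : toKer h (j + 1 + 1) ∘ₗ P.d (j + 1) = 0 :=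
    LinearMap.ext fun x => Subtype.ext ((h (j + 1)).apply_apply_eq_zero x)
  -- The lift `f` need not descend to the cocycle module; its restriction to boundaries is a cocycle
  -- with values in Ker π, the obstruction class in Ext¹.
  let φ : P.X (j + 1) →ₗ[S] LinearMap.ker π := (f ∘ₗ P.d (j + 1)).codRestrict _ fun x => by
    rw [LinearMap.mem_ker, ← LinearMap.comp_apply, ← LinearMap.comp_assoc, hf, hd,
      LinearMap.zero_apply]
  obtain ⟨ψ, hψ⟩ := (homAcyclic_iff h).1 H j φ (LinearMap.ext fun x => Subtype.ext (by
    change f (P.d (j + 1) (P.d j x)) = 0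
    rw [(h j).apply_apply_eq_zero, map_zero]))
  -- Corrected by the extension ψ of the obstruction, the lift vanishes on boundaries and descends.
  let f' := f - (LinearMap.ker π).subtype ∘ₗ ψ
  have hf' : ∀ x, π (f' x) = toKer h (j + 1 + 1) x := fun x => by
    change π (f x - (ψ x).1) = _
    rw [map_sub, (ψ x).2, sub_zero]
    exact LinearMap.congr_fun hf x
  have hf'' : LinearMap.ker (toKer h (j + 1 + 1)) ≤ LinearMap.ker f' := fun x hx => by
    obtain ⟨y, rfl⟩ := (h (j + 1) x).1 (congrArg Subtype.val hx)
    change f _ - (ψ _).1 = 0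
    rw [show ψ (P.d (j + 1) y) = φ y from LinearMap.congr_fun hψ y]
    exact sub_self _
  let e := (toKer h (j + 1 + 1)).quotKerEquivOfSurjective (toKer_surjective h _)
  refine ⟨(LinearMap.ker (toKer h (j + 1 + 1))).liftQ f' hf'' ∘ₗ e.symm.toLinearMap,
    LinearMap.ext fun y => ?_⟩
  obtain ⟨x, rfl⟩ := toKer_surjective h _ y
  have he : e.symm (toKer h (j + 1 + 1) x) = Submodule.Quotient.mk x :=
    e.symm_apply_eq.2 rfl
  simp only [LinearMap.comp_apply, LinearEquiv.coe_coe, he, Submodule.liftQ_apply, hf',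
    LinearMap.id_apply]

end ModSeq

theorem IsGorensteinProjective.of_equiv {G G' : Type u} [AddCommGroup G] [Module S G]
    [AddCommGroup G'] [Module S G'] (h : IsGorensteinProjective (ModuleCat.of S G))
    (e : G' ≃ₗ[S] G) : IsGorensteinProjective (ModuleCat.of S G') := by
  obtain ⟨P, hP, ⟨e'⟩⟩ := h
  exact ⟨P, hP, ⟨e.trans e'⟩⟩

/-- A finitely generated projective module is Gorenstein-projective. -/
theorem IsGorensteinProjective.of_projective (Q : Type u) [AddCommGroup Q] [Module S Q]
    [Module.Finite S Q] [Module.Projective S Q] :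
    IsGorensteinProjective (ModuleCat.of S Q) := by
  -- The differential is (x, y) ↦ (y, 0): a sum of shifts of the identity complex Q → Q, with all
  -- cocycle modules Q × 0.
  let P : ModSeq S := ⟨fun _ => ModuleCat.of S (Q × Q), fun _ =>
    LinearMap.inl S Q Q ∘ₗ LinearMap.snd S Q Q⟩
  have hP : P.Acyclic := fun i x => by
    change (x.2, (0 : Q)) = 0 ↔ ∃ y : Q × Q, (y.2, 0) = x
    constructor
    · intro hx
      exact ⟨(0, x.1), Prod.ext rfl (congrArg Prod.fst hx).symm⟩
    · rintro ⟨y, rfl⟩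
      rfl
  have e : ∀ i, Nonempty (Q ≃ₗ[S] LinearMap.ker (P.d i)) := fun i => by
    refine ⟨LinearEquiv.ofBijective ((LinearMap.inl S Q Q).codRestrict _ fun x => rfl)
      ⟨fun x y h => congrArg (fun z => z.1.1) h, ?_⟩⟩
    rintro ⟨⟨x, y⟩, h⟩
    exact ⟨x, Subtype.ext (Prod.ext rfl (congrArg Prod.fst h).symm)⟩
  refine ⟨P, ⟨fun _ => inferInstanceAs (Module.Finite S (Q × Q)),
    fun _ => inferInstanceAs (Module.Projective S (Q × Q)), hP, fun L _ _ =>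
      ModSeq.homAcyclic_of_projective_ker (L := L) hP fun i => ?_⟩, e 0⟩
  exact Module.Projective.of_equiv (e i).some

end ModSeqLemmas

/-! ## Restriction and extension of scalars -/

section Scalars

variable {S A : Type u} [Ring S] [Ring A]

/-- An `A`-module, viewed as an `S`-module along a ring homomorphism `S → A`. -/
@[nolint unusedArguments]
def Inflation (_φ : S →+* A) (X : Type u) : Type u := X

/-- A right `A`-module, viewed as a right `S`-module along a ring homomorphism `S → A`. -/
@[nolint unusedArguments]
def RightInflation (_φ : S →+* A) (V : Type u) : Type u := V

variable (φ : S →+* A)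

section

variable (X : Type u) [AddCommGroup X]

instance : AddCommGroup (Inflation φ X) := inferInstanceAs (AddCommGroup X)

instance [Module A X] : Module S (Inflation φ X) := Module.compHom X φ

instance : AddCommGroup (RightInflation φ X) := inferInstanceAs (AddCommGroup X)

instance [Module Aᵐᵒᵖ X] : Module Sᵐᵒᵖ (RightInflation φ X) := Module.compHom X (RingHom.op φ)

instance {K : Type*} [Ring K] [Module K X] : Module K (RightInflation φ X) :=
  inferInstanceAs (Module K X)

instance {K : Type*} [Ring K] [Module K X] [Module Aᵐᵒᵖ X] [h : SMulCommClass K Aᵐᵒᵖ X] :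
    SMulCommClass K Sᵐᵒᵖ (RightInflation φ X) where
  smul_comm k s x := h.smul_comm k (MulOpposite.op (φ s.unop)) x

end

namespace Inflation

variable {φ} {X Y : Type u} [AddCommGroup X] [Module A X] [AddCommGroup Y] [Module A Y]

/-- The identity map from `X` to its inflation. -/
def of : X ≃+ Inflation φ X := AddEquiv.refl X

theorem smul_of (s : S) (x : X) : s • (of x : Inflation φ X) = of (φ s • x) := rfl

theorem of_symm_smul (s : S) (x : Inflation φ X) : of.symm (s • x) = φ s • of.symm x := rfl

variable (φ) in
/-- A linear map, viewed as a linear map between the inflations. -/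
def map (f : X →ₗ[A] Y) : Inflation φ X →ₗ[S] Inflation φ Y where
  toFun x := of (f (of.symm x))
  map_add' := by simp
  map_smul' s x := by simp [of_symm_smul, smul_of]

end Inflation

namespace RightInflation

variable {φ} {Z V G : Type u} [AddCommGroup Z] [Module S Z] [AddCommGroup V] [Module Aᵐᵒᵖ V]
  [AddCommGroup G]

variable (φ) in
/-- The pure tensor `v ⊗ z` in `V ⊗_S Z`. -/
def tmul (v : V) (z : Z) : NCTensor S (RightInflation φ V) Z :=
  NCTensor.tmul S (M := RightInflation φ V) v z

theorem add_tmul (v v' : V) (z : Z) : tmul φ (v + v') z = tmul φ v z + tmul φ v' z :=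
  NCTensor.add_tmul (M := RightInflation φ V) v v' z

theorem tmul_add (v : V) (z z' : Z) : tmul φ v (z + z') = tmul φ v z + tmul φ v z' :=
  NCTensor.tmul_add (M := RightInflation φ V) v z z'

theorem smul_tmul (v : V) (s : S) (z : Z) :
    tmul φ (MulOpposite.op (φ s) • v) z = tmul φ v (s • z) :=
  NCTensor.smul_tmul (M := RightInflation φ V) v s z

theorem smul_tmul' {K : Type*} [Ring K] [Module K V] [SMulCommClass K Aᵐᵒᵖ V] (k : K) (v : V)
    (z : Z) : k • tmul φ v z = tmul φ (k • v) z := rfl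

theorem induction {p : NCTensor S (RightInflation φ V) Z → Prop} (h0 : p 0)
    (ht : ∀ (v : V) z, p (tmul φ v z)) (ha : ∀ s t, p s → p t → p (s + t))
    (t : NCTensor S (RightInflation φ V) Z) : p t :=
  NCTensor.induction h0 ht ha t

/-- The universal property of `V ⊗_S Z`. -/
def lift (f : V → Z → G) (add_left : ∀ v v' z, f (v + v') z = f v z + f v' z)
    (add_right : ∀ v z z', f v (z + z') = f v z + f v z')
    (balanced : ∀ v (s : S) z, f (MulOpposite.op (φ s) • v) z = f v (s • z)) :
    NCTensor S (RightInflation φ V) Z →+ G :=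
  NCTensor.lift (M := RightInflation φ V) (AddMonoidHom.mk' (fun v : V => AddMonoidHom.mk' (f v)
    (add_right v)) (fun v v' => by ext z; exact add_left v v' z)) balanced

@[simp] theorem lift_tmul (f : V → Z → G) (h₁ h₂ h₃) (v : V) (z : Z) :
    lift (φ := φ) f h₁ h₂ h₃ (tmul φ v z) = f v z := rfl

end RightInflation

/-- The `A`-module `A ⊗_S Z`. -/
abbrev ScalarExtension (Z : Type u) [AddCommGroup Z] [Module S Z] : Type u :=
  NCTensor S (RightInflation φ A) Z

namespace ScalarExtension

variable {φ} {Z Z' X V : Type u} [AddCommGroup Z] [Module S Z] [AddCommGroup Z'] [Module S Z']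
  [AddCommGroup X] [Module A X] [AddCommGroup V] [Module Aᵐᵒᵖ V]

variable (φ) in
/-- The map `z ↦ 1 ⊗ z`. -/
def unit : Z →+ ScalarExtension φ Z :=
  AddMonoidHom.mk' (RightInflation.tmul φ (1 : A)) (RightInflation.tmul_add _)

theorem tmul_eq (a : A) (z : Z) : RightInflation.tmul φ a z = a • unit φ z := by
  change _ = RightInflation.tmul φ (a * 1) z
  rw [mul_one]

theorem unit_smul (s : S) (z : Z) : unit φ (s • z) = φ s • unit φ z := by
  rw [← tmul_eq]
  refine (RightInflation.smul_tmul 1 s z).symm.trans ?_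
  rw [op_smul_eq_mul, one_mul]

@[elab_as_elim]
theorem induction {p : ScalarExtension φ Z → Prop} (h0 : p 0) (hu : ∀ (a : A) z, p (a • unit φ z))
    (ha : ∀ s t, p s → p t → p (s + t)) (t : ScalarExtension φ Z) : p t :=
  RightInflation.induction h0 (fun a z => by rw [tmul_eq]; exact hu a z) ha t

theorem hom_ext {f g : ScalarExtension φ Z →ₗ[A] X} (h : ∀ z, f (unit φ z) = g (unit φ z)) :
    f = g := by
  ext t
  induction t using ScalarExtension.induction with
  | h0 => simp
  | hu a z => rw [map_smul, map_smul, h]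
  | ha s t hs ht => rw [map_add, map_add, hs, ht]

/-- The map `A ⊗_S Z → X` that corresponds to an `S`-linear map `Z → X`. -/
def lift (f : Z →ₗ[S] Inflation φ X) : ScalarExtension φ Z →ₗ[A] X where
  toFun := RightInflation.lift (fun (a : A) z => a • Inflation.of.symm (f z))
    (fun a a' z => add_smul a a' _) (fun a z z' => by rw [map_add, map_add, smul_add])
    (fun a s z => by
      rw [map_smul, Inflation.of_symm_smul, smul_smul, op_smul_eq_mul])
  map_add' := map_add _
  map_smul' k t := by
    rw [RingHom.id_apply]
    induction t using RightInflation.induction with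
    | h0 => simp
    | ht a z =>
      rw [RightInflation.smul_tmul', RightInflation.lift_tmul, RightInflation.lift_tmul,
        smul_eq_mul, mul_smul]
    | ha s t hs ht => rw [smul_add, map_add, map_add, hs, ht, smul_add]

@[simp] theorem lift_unit (f : Z →ₗ[S] Inflation φ X) (z : Z) :
    lift f (unit φ z) = Inflation.of.symm (f z) :=
  one_smul A (Inflation.of.symm (f z))

/-- The `S`-linear map `Z → X` that corresponds to a map `A ⊗_S Z → X`. -/
def restrict (f : ScalarExtension φ Z →ₗ[A] X) : Z →ₗ[S] Inflation φ X where
  toFun z := Inflation.of (f (unit φ z))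
  map_add' z z' := by rw [map_add, map_add, map_add]
  map_smul' s z := by rw [unit_smul, map_smul]; rfl

instance [Module.Finite S Z] [Module.Projective S Z] : Module.Finite A (ScalarExtension φ Z) := by
  obtain ⟨n, i, r, h⟩ := NCTensor.exists_retract (A := S) A (RightInflation φ A) (X := Z)
  have : Module.Finite A (RightInflation φ A) := inferInstanceAs (Module.Finite A A)
  exact Module.Finite.of_surjective r fun x => ⟨i x, LinearMap.congr_fun h x⟩

instance [Module.Finite S Z] [Module.Projective S Z] :
    Module.Projective A (ScalarExtension φ Z) := by
  obtain ⟨n, i, r, h⟩ := NCTensor.exists_retract (A := S) A (RightInflation φ A) (X := Z)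
  have : Module.Projective A (Fin n → RightInflation φ A) :=
    inferInstanceAs (Module.Projective A (Fin n → A))
  exact Module.Projective.of_split i r h

/-- The map `V ⊗_A (A ⊗_S Z) → V ⊗_S Z`. -/
def assocHom : NCTensor A V (ScalarExtension φ Z) →+ NCTensor S (RightInflation φ V) Z := by
  -- The map sends v ⊗ (a ⊗ z) to va ⊗ z.
  let F : V → ScalarExtension φ Z →+ NCTensor S (RightInflation φ V) Z := fun v =>
    RightInflation.lift (fun (a : A) z => RightInflation.tmul φ (MulOpposite.op a • v) z)
      (fun a a' z => by rw [MulOpposite.op_add, add_smul, RightInflation.add_tmul])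
      (fun a z z' => RightInflation.tmul_add _ _ _)
      (fun a s z => by
        rw [op_smul_eq_mul, MulOpposite.op_mul, mul_smul, RightInflation.smul_tmul])
  have hF : ∀ v (a : A) z, F v (a • unit φ z) =
      RightInflation.tmul φ (MulOpposite.op a • v) z := fun v a z => by
    rw [← tmul_eq]
    rfl
  refine NCTensor.lift (AddMonoidHom.mk' F fun v v' => ?_) fun v a t => ?_
  · ext t
    rw [AddMonoidHom.add_apply]
    induction t using ScalarExtension.induction with
    | h0 => simp
    | hu a z => rw [hF, hF, hF, smul_add, RightInflation.add_tmul]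
    | ha s t hs ht => rw [map_add, map_add, map_add, hs, ht]; abel
  · change F _ t = F _ (a • t)
    induction t using ScalarExtension.induction with
    | h0 => simp
    | hu b z => rw [smul_smul, hF, hF, smul_smul, MulOpposite.op_mul]
    | ha s t hs ht => rw [smul_add, map_add, map_add, hs, ht]

theorem assocHom_tmul_smul_unit (v : V) (a : A) (z : Z) :
    assocHom (NCTensor.tmul A v (a • unit φ z)) =
      RightInflation.tmul φ (MulOpposite.op a • v) z := by
  rw [← tmul_eq]
  rfl

variable (φ V Z) in
/-- The isomorphism `V ⊗_A (A ⊗_S Z) ≅ V ⊗_S Z`. -/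
def assoc : NCTensor A V (ScalarExtension φ Z) ≃+ NCTensor S (RightInflation φ V) Z :=
  AddMonoidHom.toAddEquiv assocHom
    (RightInflation.lift (fun v z => NCTensor.tmul A v (unit φ z))
      (fun v v' z => NCTensor.add_tmul v v' _)
      (fun v z z' => by rw [map_add, NCTensor.tmul_add])
      (fun v s z => by rw [unit_smul, NCTensor.smul_tmul]))
    (NCTensor.hom_ext fun v t => by
      simp only [AddMonoidHom.comp_apply, AddMonoidHom.id_apply]
      induction t using ScalarExtension.induction with
      | h0 => simp [NCTensor.tmul_zero]
      | hu b z => rw [assocHom_tmul_smul_unit, RightInflation.lift_tmul, NCTensor.smul_tmul]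
      | ha s t hs ht => rw [NCTensor.tmul_add, map_add, map_add, hs, ht])
    (by
      ext t
      simp only [AddMonoidHom.comp_apply, AddMonoidHom.id_apply]
      induction t using RightInflation.induction with
      | h0 => simp
      | ht v z =>
        rw [RightInflation.lift_tmul, ← one_smul A (unit φ z), assocHom_tmul_smul_unit,
          MulOpposite.op_one, one_smul]
      | ha s t hs ht => rw [map_add, map_add, hs, ht])

@[simp] theorem assoc_symm_tmul (v : V) (z : Z) :
    (assoc φ Z V).symm (RightInflation.tmul φ v z) = NCTensor.tmul A v (unit φ z) := rfl

variable (φ V Z) in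
/-- The isomorphism `V ⊗_A (A ⊗_S Z) ≅ V ⊗_S Z` for a bimodule `V`. -/
def assocLinear (K : Type*) [Ring K] [Module K V] [SMulCommClass K Aᵐᵒᵖ V] :
    NCTensor A V (ScalarExtension φ Z) ≃ₗ[K] NCTensor S (RightInflation φ V) Z :=
  LinearEquiv.symm { (assoc φ Z V).symm with
    map_smul' k t := by
      change (assoc φ Z V).symm (k • t) = k • (assoc φ Z V).symm t
      induction t using RightInflation.induction with
      | h0 => simp
      | ht v z => rw [RightInflation.smul_tmul', assoc_symm_tmul, assoc_symm_tmul]; rfl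
      | ha s t hs ht => rw [smul_add, map_add, map_add, hs, ht, smul_add] }

theorem assoc_symm_map (f : Z →ₗ[S] Z') (t : NCTensor S (RightInflation φ V) Z) :
    (assoc φ Z' V).symm (NCTensor.map _ f t) =
      NCTensor.map V (NCTensor.mapLinear A (RightInflation φ A) f) ((assoc φ Z V).symm t) := by
  induction t using RightInflation.induction with
  | h0 => simp
  | ht v z => rfl
  | ha s t hs ht => simp only [map_add, hs, ht]

end ScalarExtension

namespace ModSeq

/-- The sequence `A ⊗_S P`. -/
def scalarExtension (P : ModSeq S) : ModSeq A where
  X i := ModuleCat.of A (ScalarExtension φ (P.X i))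
  d i := NCTensor.mapLinear A (RightInflation φ A) (P.d i)

variable {φ} {P : ModSeq S}

/-- The adjunction Hom_A(A ⊗_S P, Q) = Hom_S(P, Q), natural in P. -/
theorem homAcyclic_scalarExtension_iff (h : P.Acyclic) (h' : (P.scalarExtension φ).Acyclic)
    {Q : Type u} [AddCommGroup Q] [Module A Q] :
    (P.scalarExtension φ).HomAcyclic (ModuleCat.of A Q) ↔
      P.HomAcyclic (ModuleCat.of S (Inflation φ Q)) := by
  rw [homAcyclic_iff h, homAcyclic_iff h']
  constructor
  · intro H i f hf
    obtain ⟨g, hg⟩ := H i (ScalarExtension.lift f) (ScalarExtension.hom_ext fun z => by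
      refine (ScalarExtension.lift_unit f (P.d i z)).trans ?_
      exact LinearMap.congr_fun hf z)
    refine ⟨ScalarExtension.restrict g, LinearMap.ext fun z => ?_⟩
    exact (LinearMap.congr_fun hg (ScalarExtension.unit φ z)).trans (ScalarExtension.lift_unit f z)
  · intro H i f hf
    obtain ⟨g, hg⟩ := H i (ScalarExtension.restrict f) (LinearMap.ext fun z =>
      LinearMap.congr_fun hf (ScalarExtension.unit φ z))
    refine ⟨ScalarExtension.lift g, ScalarExtension.hom_ext fun z => ?_⟩
    exact (ScalarExtension.lift_unit g (P.d (i + 1) z)).trans (LinearMap.congr_fun hg z)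

/-- The two complexes are isomorphic by associativity, V ⊗_A (A ⊗_S P) ≅ V ⊗_S P. -/
theorem tensorAcyclic_scalarExtension_iff {V : Type u} [AddCommGroup V] [Module Aᵐᵒᵖ V] :
    (P.scalarExtension φ).TensorAcyclic (ModuleCat.of Aᵐᵒᵖ V) ↔
      P.TensorAcyclic (ModuleCat.of Sᵐᵒᵖ (RightInflation φ V)) :=
  forall_congr' fun i => Function.Exact.iff_of_ladder_addEquiv
    (e₁ := (ScalarExtension.assoc φ (P.X i) V).symm)
    (e₂ := (ScalarExtension.assoc φ (P.X (i + 1)) V).symm)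
    (e₃ := (ScalarExtension.assoc φ (P.X (i + 1 + 1)) V).symm)
    (AddMonoidHom.ext fun t => (ScalarExtension.assoc_symm_map (P.d i) t).symm)
    (AddMonoidHom.ext fun t => (ScalarExtension.assoc_symm_map (P.d (i + 1)) t).symm)

end ModSeq

end Scalars

/-! ## Rings presented as Morita rings

Working with a ring `L` that is isomorphic to a Morita ring, instead of the Morita ring itself,
allows to exchange the roles of `A` and `B` without changing the ring. -/

section Morita

variable {L A N M B : Type u} [Ring L] [Ring A] [Ring B]
  [AddCommGroup M] [Module B M] [Module Aᵐᵒᵖ M] [SMulCommClass B Aᵐᵒᵖ M]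
  [AddCommGroup N] [Module A N] [Module Bᵐᵒᵖ N] [SMulCommClass A Bᵐᵒᵖ N]

/-- The exchange of the two diagonal entries. -/
def MoritaRing.swapEquiv : MoritaRing A N M B ≃+* MoritaRing B M N A where
  toFun x := ⟨x.b, x.m, x.n, x.a⟩
  invFun x := ⟨x.b, x.m, x.n, x.a⟩
  map_mul' x y := by ext <;> simp [add_comm]
  map_add' x y := rfl

variable (L A N M B) in
/-- A presentation of the ring `L` as a Morita ring. -/
structure MoritaPresentation where
  equiv : L ≃+* MoritaRing A N M B

namespace MoritaPresentation

variable (D : MoritaPresentation L A N M B)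

/-- The presentation with the roles of `A` and `B` exchanged. -/
def swap : MoritaPresentation L B M N A := ⟨D.equiv.trans MoritaRing.swapEquiv⟩

/-- The diagonal entry in `A`. -/
def projA : L →+* A where
  toFun l := (D.equiv l).a
  map_one' := by simp
  map_mul' := by simp
  map_zero' := by simp
  map_add' := by simp

/-- The diagonal entry in `B`. -/
def projB : L →+* B where
  toFun l := (D.equiv l).b
  map_one' := by simp
  map_mul' := by simp
  map_zero' := by simp
  map_add' := by simp

/-- The entry in `M`. -/
def projM : L →+ M where
  toFun l := (D.equiv l).m
  map_zero' := by simp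
  map_add' := by simp

/-- The entry in `N`. -/
def projN : L →+ N where
  toFun l := (D.equiv l).n
  map_zero' := by simp
  map_add' := by simp

/-- The inclusion of `A` as a corner. -/
def ofA : A →+ L where
  toFun a := D.equiv.symm ⟨a, 0, 0, 0⟩
  map_zero' := D.equiv.symm_apply_eq.2 (by rw [map_zero]; rfl)
  map_add' a a' := D.equiv.symm_apply_eq.2 (by rw [map_add]; ext <;> simp)

/-- The inclusion of `B` as a corner. -/
def ofB : B →+ L where
  toFun b := D.equiv.symm ⟨0, 0, 0, b⟩
  map_zero' := D.equiv.symm_apply_eq.2 (by rw [map_zero]; rfl)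
  map_add' a a' := D.equiv.symm_apply_eq.2 (by rw [map_add]; ext <;> simp)

/-- The inclusion of `M`. -/
def ofM : M →+ L where
  toFun m := D.equiv.symm ⟨0, 0, m, 0⟩
  map_zero' := D.equiv.symm_apply_eq.2 (by rw [map_zero]; rfl)
  map_add' a a' := D.equiv.symm_apply_eq.2 (by rw [map_add]; ext <;> simp)

/-- The inclusion of `N`. -/
def ofN : N →+ L where
  toFun n := D.equiv.symm ⟨0, n, 0, 0⟩
  map_zero' := D.equiv.symm_apply_eq.2 (by rw [map_zero]; rfl)
  map_add' a a' := D.equiv.symm_apply_eq.2 (by rw [map_add]; ext <;> simp)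

section Entries

theorem equiv_ofA (a : A) : D.equiv (D.ofA a) = ⟨a, 0, 0, 0⟩ := D.equiv.apply_symm_apply _

theorem equiv_ofB (b : B) : D.equiv (D.ofB b) = ⟨0, 0, 0, b⟩ := D.equiv.apply_symm_apply _

theorem equiv_ofM (m : M) : D.equiv (D.ofM m) = ⟨0, 0, m, 0⟩ := D.equiv.apply_symm_apply _

theorem equiv_ofN (n : N) : D.equiv (D.ofN n) = ⟨0, n, 0, 0⟩ := D.equiv.apply_symm_apply _

theorem ofA_one_add_ofB_one : D.ofA 1 + D.ofB 1 = 1 := by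
  apply D.equiv.injective
  ext <;> simp [equiv_ofA, equiv_ofB]

variable (a a' : A) (b b' : B) (m m' : M) (n n' : N) (l l' : L)

@[simp] theorem projA_ofA : D.projA (D.ofA a) = a := congrArg MoritaRing.a (D.equiv_ofA a)
@[simp] theorem projB_ofA : D.projB (D.ofA a) = 0 := congrArg MoritaRing.b (D.equiv_ofA a)
@[simp] theorem projM_ofA : D.projM (D.ofA a) = 0 := congrArg MoritaRing.m (D.equiv_ofA a)
@[simp] theorem projA_ofM : D.projA (D.ofM m) = 0 := congrArg MoritaRing.a (D.equiv_ofM m)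
@[simp] theorem projB_ofM : D.projB (D.ofM m) = 0 := congrArg MoritaRing.b (D.equiv_ofM m)
@[simp] theorem projM_ofM : D.projM (D.ofM m) = m := congrArg MoritaRing.m (D.equiv_ofM m)
@[simp] theorem projA_ofN : D.projA (D.ofN n) = 0 := congrArg MoritaRing.a (D.equiv_ofN n)

@[simp] theorem projN_ofA : D.projN (D.ofA a) = 0 := congrArg MoritaRing.n (D.equiv_ofA a)
@[simp] theorem projN_ofN : D.projN (D.ofN n) = n := congrArg MoritaRing.n (D.equiv_ofN n)

@[simp] theorem projM_one : D.projM 1 = 0 := by simp [projM]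

theorem projM_mul : D.projM (l * l') =
    MulOpposite.op (D.projA l') • D.projM l + D.projB l • D.projM l' := by
  simp [projM, projA, projB]

theorem projN_mul : D.projN (l * l') =
    D.projA l • D.projN l' + MulOpposite.op (D.projB l') • D.projN l := by
  simp [projN, projA, projB]

@[simp] theorem ofA_mul_ofA : D.ofA a * D.ofA a' = D.ofA (a * a') :=
  D.equiv.injective (by ext <;> simp [equiv_ofA])
@[simp] theorem ofA_mul_ofN : D.ofA a * D.ofN n = D.ofN (a • n) :=
  D.equiv.injective (by ext <;> simp [equiv_ofA, equiv_ofN])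
@[simp] theorem ofB_mul_ofA : D.ofB b * D.ofA a = 0 :=
  D.equiv.injective (by ext <;> simp [equiv_ofA, equiv_ofB])
@[simp] theorem ofM_mul_ofA : D.ofM m * D.ofA a = D.ofM (MulOpposite.op a • m) :=
  D.equiv.injective (by ext <;> simp [equiv_ofA, equiv_ofM])
@[simp] theorem ofM_mul_ofN : D.ofM m * D.ofN n = 0 :=
  D.equiv.injective (by ext <;> simp [equiv_ofM, equiv_ofN])

theorem ofN_mul : D.ofN n * l = D.ofN (MulOpposite.op (D.projB l) • n) :=
  D.equiv.injective (by ext <;> simp [equiv_ofN, projB])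

theorem mul_ofA : l * D.ofA a = D.ofA (D.projA l * a) + D.ofM (MulOpposite.op a • D.projM l) :=
  D.equiv.injective (by ext <;> simp [equiv_ofM, equiv_ofA, projA, projM])

theorem ofA_mul : D.ofA a * l = D.ofA (a * D.projA l) + D.ofN (a • D.projN l) :=
  D.equiv.injective (by ext <;> simp [equiv_ofN, equiv_ofA, projA, projN])

theorem mul_ofM : l * D.ofM m = D.ofM (D.projB l • m) :=
  D.equiv.injective (by ext <;> simp [equiv_ofM, projB])

end Entries

/-! ### Corners of modules -/

section Corner

variable (Z : Type u) [AddCommGroup Z] [Module L Z]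

/-- The `A`-component of an `L`-module. -/
def corner : AddSubgroup Z where
  carrier := {z | D.ofA 1 • z = z}
  zero_mem' := smul_zero _
  add_mem' {z z'} hz hz' := by
    change D.ofA 1 • (z + z') = z + z'
    rw [smul_add, hz, hz']
  neg_mem' {z} hz := by
    change D.ofA 1 • (-z) = -z
    rw [smul_neg, hz]

variable {Z}

theorem mem_corner {z : Z} : z ∈ D.corner Z ↔ D.ofA 1 • z = z := Iff.rfl

theorem ofA_smul_mem (a : A) (z : Z) : D.ofA a • z ∈ D.corner Z := by
  rw [mem_corner, smul_smul, ofA_mul_ofA, one_mul]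

theorem ofN_smul_mem (n : N) (z : Z) : D.ofN n • z ∈ D.corner Z := by
  rw [mem_corner, smul_smul, ofA_mul_ofN, one_smul]

/-- Such a z equals e_A z, and l e_A is the first column of l, with entries in A and M only. -/
theorem smul_of_mem {z : Z} (hz : z ∈ D.corner Z) (l : L) :
    l • z = D.ofA (D.projA l) • z + D.ofM (D.projM l) • z := by
  rw [mem_corner] at hz
  rw [← hz, smul_smul, mul_ofA, smul_smul, smul_smul, add_smul]
  simp

instance : Module A (D.corner Z) where
  smul a z := ⟨D.ofA a • z.1, D.ofA_smul_mem a z.1⟩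
  one_smul z := Subtype.ext z.2
  mul_smul a a' z := Subtype.ext (by
    change D.ofA (a * a') • z.1 = D.ofA a • D.ofA a' • z.1
    rw [smul_smul, ofA_mul_ofA])
  smul_zero a := Subtype.ext (smul_zero (D.ofA a))
  smul_add a z z' := Subtype.ext (smul_add (D.ofA a) z.1 z'.1)
  add_smul a a' z := Subtype.ext (by
    change D.ofA (a + a') • z.1 = D.ofA a • z.1 + D.ofA a' • z.1
    rw [map_add, add_smul])
  zero_smul z := Subtype.ext (by
    change D.ofA 0 • z.1 = 0
    rw [map_zero, zero_smul])

theorem corner_smul_val (a : A) (z : D.corner Z) : (a • z).1 = D.ofA a • z.1 := rfl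

variable {Z' : Type u} [AddCommGroup Z'] [Module L Z']

/-- The map between the `A`-components. -/
def cornerMap (f : Z →ₗ[L] Z') : D.corner Z →ₗ[A] D.corner Z' where
  toFun z := ⟨f z.1, (f.map_smul (D.ofA 1) z.1).symm.trans (congrArg f z.2)⟩
  map_add' z z' := Subtype.ext (map_add f z.1 z'.1)
  map_smul' a z := Subtype.ext (map_smul f (D.ofA a) z.1)

@[simp] theorem cornerMap_val (f : Z →ₗ[L] Z') (z : D.corner Z) : (D.cornerMap f z).1 = f z.1 :=
  rfl

/-- Cutting by the idempotent e_A is exact: multiply any preimage by it. -/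
theorem cornerMap_surjective {f : Z →ₗ[L] Z'} (hf : Function.Surjective f) :
    Function.Surjective (D.cornerMap f) := fun z => by
  obtain ⟨y, hy⟩ := hf z.1
  refine ⟨⟨D.ofA 1 • y, D.ofA_smul_mem 1 y⟩, Subtype.ext ?_⟩
  rw [cornerMap_val, map_smul, hy]
  exact z.2

/-- The isomorphism between the `A`-components of isomorphic modules. -/
def cornerCongr (e : Z ≃ₗ[L] Z') : D.corner Z ≃ₗ[A] D.corner Z' :=
  LinearEquiv.ofLinearMap (D.cornerMap e.toLinearMap) (D.cornerMap e.symm.toLinearMap)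
    (LinearMap.ext fun z => Subtype.ext (e.apply_symm_apply z.1))
    (LinearMap.ext fun z => Subtype.ext (e.symm_apply_apply z.1))

/-- The `A`-component of a product. -/
def cornerProd : D.corner (Z × Z') ≃ₗ[A] D.corner Z × D.corner Z' :=
  LinearEquiv.ofLinearMap
    ((D.cornerMap (LinearMap.fst L Z Z')).prod (D.cornerMap (LinearMap.snd L Z Z')))
    ((D.cornerMap (LinearMap.inl L Z Z')).coprod (D.cornerMap (LinearMap.inr L Z Z')))
    (LinearMap.ext fun z => by ext <;> simp)
    (LinearMap.ext fun z => by ext <;> simp)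

end Corner

/-! ### Induced modules -/

/-- The left `L`-module `(X, M ⊗_A X)` with structure maps `id` and `0`. -/
@[ext] structure Induced (D : MoritaPresentation L A N M B) (X : Type u) [AddCommGroup X]
    [Module A X] where
  fst : X
  snd : NCTensor A M X

namespace Induced

variable {D} {X Y : Type u} [AddCommGroup X] [Module A X] [AddCommGroup Y] [Module A Y]

variable (D X) in
/-- The underlying set of an induced module is a product. -/
def equivProd : D.Induced X ≃ X × NCTensor A M X where
  toFun w := (w.fst, w.snd)
  invFun w := ⟨w.1, w.2⟩

instance : AddCommGroup (D.Induced X) := (equivProd D X).addCommGroup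

@[simp] theorem zero_fst : (0 : D.Induced X).fst = 0 := rfl
@[simp] theorem zero_snd : (0 : D.Induced X).snd = 0 := rfl
@[simp] theorem add_fst (w w' : D.Induced X) : (w + w').fst = w.fst + w'.fst := rfl
@[simp] theorem add_snd (w w' : D.Induced X) : (w + w').snd = w.snd + w'.snd := rfl

instance : SMul L (D.Induced X) :=
  ⟨fun l w => ⟨D.projA l • w.fst, NCTensor.tmul A (D.projM l) w.fst + D.projB l • w.snd⟩⟩

@[simp] theorem smul_fst (l : L) (w : D.Induced X) : (l • w).fst = D.projA l • w.fst := rfl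
@[simp] theorem smul_snd (l : L) (w : D.Induced X) :
    (l • w).snd = NCTensor.tmul A (D.projM l) w.fst + D.projB l • w.snd := rfl

instance : Module L (D.Induced X) where
  one_smul w := by ext <;> simp [NCTensor.zero_tmul]
  mul_smul l l' w := by
    ext
    · simp [mul_smul]
    · simp only [smul_snd, smul_fst, projM_mul, NCTensor.add_tmul, NCTensor.smul_tmul, map_mul,
        smul_add, mul_smul, NCTensor.smul_tmul', add_assoc]
  smul_zero l := by ext <;> simp [NCTensor.tmul_zero]
  smul_add l w w' := by
    ext
    · simp
    · simp only [smul_snd, add_fst, add_snd, NCTensor.tmul_add, smul_add]; abel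
  add_smul l l' w := by
    ext
    · simp [add_smul]
    · simp only [smul_snd, add_snd, map_add, NCTensor.add_tmul, add_smul]; abel
  zero_smul w := by ext <;> simp [NCTensor.zero_tmul]

variable (D X) in
/-- The map `x ↦ (x, 0)`. -/
def unit : X →ₗ[A] D.corner (D.Induced X) where
  toFun x := ⟨⟨x, 0⟩, by rw [mem_corner]; ext <;> simp [NCTensor.zero_tmul]⟩
  map_add' x x' := Subtype.ext (by ext <;> simp)
  map_smul' a x := Subtype.ext (by
    rw [corner_smul_val]; ext <;> simp [NCTensor.zero_tmul])

@[simp] theorem unit_fst (x : X) : (unit D X x).1.fst = x := rfl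
@[simp] theorem unit_snd (x : X) : (unit D X x).1.snd = 0 := rfl

/-- This is why an induced module is generated over `L` by its `A`-component. -/
theorem mk_tmul (m : M) (x : X) :
    (⟨0, NCTensor.tmul A m x⟩ : D.Induced X) = D.ofM m • (unit D X x).1 := by
  ext <;> simp

theorem eq_unit_add (w : D.Induced X) : w = (unit D X w.fst).1 + ⟨0, w.snd⟩ := by
  ext <;> simp

@[elab_as_elim]
theorem induction {p : D.Induced X → Prop} (hu : ∀ (l : L) x, p (l • (unit D X x).1))
    (ha : ∀ w w', p w → p w' → p (w + w')) (w : D.Induced X) : p w := by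
  rw [eq_unit_add w]
  refine ha _ _ (by simpa using hu 1 w.fst) ?_
  induction w.snd using NCTensor.induction with
  | h0 =>
    have h := hu 0 0
    rwa [zero_smul] at h
  | ht m x => rw [mk_tmul]; exact hu _ _
  | ha s t hs ht =>
    have : (⟨0, s + t⟩ : D.Induced X) = ⟨0, s⟩ + ⟨0, t⟩ := by ext <;> simp
    rw [this]
    exact ha _ _ hs ht

variable {Z : Type u} [AddCommGroup Z] [Module L Z]

theorem hom_ext {f g : D.Induced X →ₗ[L] Z} (h : ∀ x, f (unit D X x).1 = g (unit D X x).1) :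
    f = g := by
  ext w
  induction w using Induced.induction with
  | hu l x => rw [map_smul, map_smul, h]
  | ha w w' hw hw' => rw [map_add, map_add, hw, hw']

/-- The map `m ⊗ x ↦ m • h x`. -/
def liftSnd (h : X →ₗ[A] D.corner Z) : NCTensor A M X →+ Z :=
  NCTensor.lift (AddMonoidHom.mk' (fun m => AddMonoidHom.mk' (fun x => D.ofM m • (h x).1)
      fun x x' => by rw [map_add, AddSubgroup.coe_add, smul_add])
    fun m m' => by ext x; simp [add_smul]) fun m a x => by
      simp [corner_smul_val, smul_smul]

@[simp] theorem liftSnd_tmul (h : X →ₗ[A] D.corner Z) (m : M) (x : X) :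
    liftSnd h (NCTensor.tmul A m x) = D.ofM m • (h x).1 := rfl

/-- The map from an induced module that corresponds to a map to the `A`-component. -/
def lift (h : X →ₗ[A] D.corner Z) : D.Induced X →ₗ[L] Z where
  toFun w := (h w.fst).1 + liftSnd h w.snd
  map_add' w w' := by simp only [add_fst, add_snd, map_add, AddSubgroup.coe_add]; abel
  map_smul' l w := by
    -- Only the `B`-entry of `l` survives in a product with an element of M, so M · e_A Z is a
    -- `B`-module through `projB`.
    have key : ∀ t, liftSnd h (D.projB l • t) = l • liftSnd h t := fun t => by
      induction t using NCTensor.induction with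
      | h0 => simp
      | ht m x =>
        rw [NCTensor.smul_tmul', liftSnd_tmul, liftSnd_tmul, smul_smul, mul_ofM]
      | ha s t hs ht => rw [smul_add, map_add, map_add, hs, ht, smul_add]
    rw [smul_fst, smul_snd, map_add, key, liftSnd_tmul, map_smul, corner_smul_val,
      RingHom.id_apply, smul_add, D.smul_of_mem (h w.fst).2 l, add_assoc]

theorem lift_apply (h : X →ₗ[A] D.corner Z) (w : D.Induced X) :
    lift h w = (h w.fst).1 + liftSnd h w.snd := rfl

@[simp] theorem lift_unit (h : X →ₗ[A] D.corner Z) (x : X) : lift h (unit D X x).1 = (h x).1 := by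
  simp [lift_apply]

variable (D) in
/-- The functoriality of induced modules. -/
def map (f : X →ₗ[A] Y) : D.Induced X →ₗ[L] D.Induced Y where
  toFun w := ⟨f w.fst, NCTensor.map M f w.snd⟩
  map_add' w w' := by ext <;> simp
  map_smul' l w := by
    have key := (NCTensor.mapLinear B M f).map_smul (D.projB l) w.snd
    ext
    · simp
    · change NCTensor.map M f (NCTensor.tmul A (D.projM l) w.fst + D.projB l • w.snd) = _
      rw [map_add, NCTensor.map_tmul]
      exact congrArg _ key

@[simp] theorem map_fst (f : X →ₗ[A] Y) (w : D.Induced X) : (map D f w).fst = f w.fst := rfl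
@[simp] theorem map_snd (f : X →ₗ[A] Y) (w : D.Induced X) :
    (map D f w).snd = NCTensor.map M f w.snd := rfl

theorem map_unit (f : X →ₗ[A] Y) (x : X) : map D f (unit D X x).1 = (unit D Y (f x)).1 := by
  ext <;> simp

variable (D) in
/-- Induced modules of isomorphic modules are isomorphic. -/
def congr (e : X ≃ₗ[A] Y) : D.Induced X ≃ₗ[L] D.Induced Y :=
  LinearEquiv.ofLinearMap (map D e.toLinearMap) (map D e.symm.toLinearMap)
    (hom_ext fun x => by simp [map_unit]) (hom_ext fun x => by simp [map_unit])

variable (D X Y) in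
/-- Induction commutes with products. -/
def prodEquiv : D.Induced (X × Y) ≃ₗ[L] D.Induced X × D.Induced Y :=
  LinearEquiv.ofLinearMap ((map D (LinearMap.fst A X Y)).prod (map D (LinearMap.snd A X Y)))
    ((map D (LinearMap.inl A X Y)).coprod (map D (LinearMap.inr A X Y)))
    (by
      refine LinearMap.prod_ext (hom_ext fun x => ?_) (hom_ext fun x => ?_) <;>
        ext <;> simp)
    (hom_ext fun x => by ext <;> simp)

variable (D X) in
/-- The `A`-component of an induced module. -/
def cornerEquiv : D.corner (D.Induced X) ≃ₗ[A] X where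
  toFun w := w.1.fst
  map_add' _ _ := rfl
  map_smul' a w := by rw [corner_smul_val, smul_fst, projA_ofA]; rfl
  invFun := unit D X
  left_inv w := Subtype.ext (by
    have h := congrArg Induced.snd w.2
    ext
    · rfl
    · simpa [NCTensor.zero_tmul] using h)
  right_inv x := rfl

theorem finite [Module.Finite A X] : Module.Finite L (D.Induced X) := by
  obtain ⟨s, hs⟩ := Module.Finite.fg_top (R := A) (M := X)
  classical
  refine ⟨⟨s.image fun x => (unit D X x).1, ?_⟩⟩
  rw [eq_top_iff]
  rintro w -
  induction w using Induced.induction with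
  | hu l x =>
    refine Submodule.smul_mem _ _ ?_
    have hx : x ∈ Submodule.span A (s : Set X) := hs ▸ Submodule.mem_top
    induction hx using Submodule.span_induction with
    | mem x hx => exact Submodule.subset_span (by simpa using ⟨x, hx, rfl⟩)
    | zero => simp
    | add x y _ _ hx hy => rw [map_add]; exact Submodule.add_mem _ hx hy
    | smul a x _ hx => rw [map_smul]; exact Submodule.smul_mem _ _ hx
  | ha w w' hw hw' => exact Submodule.add_mem _ hw hw'

/-- Induction is left adjoint to the corner functor, which preserves surjections. -/
theorem projective [Module.Projective A X] : Module.Projective L (D.Induced X) := by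
  refine Module.Projective.of_lifting_property'' fun f hf => ?_
  obtain ⟨h, hh⟩ := Module.projective_lifting_property (D.cornerMap f) (unit D X)
    (D.cornerMap_surjective hf)
  exact ⟨lift h, hom_ext fun x => by
    rw [LinearMap.comp_apply, lift_unit]
    exact congrArg Subtype.val (LinearMap.congr_fun hh x)⟩

end Induced

end MoritaPresentation

end Morita

/-! ## Indecomposable modules -/

section Indecomposable

variable {S : Type u} [Ring S]

/-- Replaces categorical biproducts by linear equivalences with product modules. -/
theorem indecomposable_iff {Z : Type u} [AddCommGroup Z] [Module S Z] :
    Indecomposable (ModuleCat.of S Z) ↔ Nontrivial Z ∧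
      ∀ (X Y : Type u) [AddCommGroup X] [Module S X] [AddCommGroup Y] [Module S Y],
        (Z ≃ₗ[S] X × Y) → Subsingleton X ∨ Subsingleton Y := by
  refine and_congr ?_ ⟨fun h X Y _ _ _ _ e => ?_, fun h X Y e => ?_⟩
  · rw [ModuleCat.isZero_iff_subsingleton, not_subsingleton_iff_nontrivial]
  · have := h (ModuleCat.of S X) (ModuleCat.of S Y)
      (e.toModuleIso ≪≫ (ModuleCat.biprodIsoProd (ModuleCat.of S X) (ModuleCat.of S Y)).symm)
    rwa [ModuleCat.isZero_iff_subsingleton, ModuleCat.isZero_iff_subsingleton] at this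
  · rw [ModuleCat.isZero_iff_subsingleton, ModuleCat.isZero_iff_subsingleton]
    exact h X Y (e ≪≫ ModuleCat.biprodIsoProd _ _).toLinearEquiv

theorem Indecomposable.of_linearEquiv {Z Z' : Type u} [AddCommGroup Z] [Module S Z]
    [AddCommGroup Z'] [Module S Z'] (h : Indecomposable (ModuleCat.of S Z)) (e : Z ≃ₗ[S] Z') :
    Indecomposable (ModuleCat.of S Z') := by
  rw [indecomposable_iff] at h ⊢
  have := h.1
  exact ⟨e.symm.toEquiv.nontrivial, fun X Y _ _ _ _ e' => h.2 X Y (e.trans e')⟩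

theorem IsGorensteinProjective.finite {G : Type u} [AddCommGroup G] [Module S G]
    (h : IsGorensteinProjective (ModuleCat.of S G)) : Module.Finite S G := by
  obtain ⟨P, hP, ⟨e⟩⟩ := h
  have := ModSeq.finite_ker hP.acyclic hP.finite 0
  exact Module.Finite.equiv e.symm

end Indecomposable

/-! ## Induction and Gorenstein-projective modules -/

section Morita

variable {L A N M B : Type u} [Ring L] [Ring A] [Ring B]
  [AddCommGroup M] [Module B M] [Module Aᵐᵒᵖ M] [SMulCommClass B Aᵐᵒᵖ M]
  [AddCommGroup N] [Module A N] [Module Bᵐᵒᵖ N] [SMulCommClass A Bᵐᵒᵖ N]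

namespace MoritaPresentation

variable (D : MoritaPresentation L A N M B)

/-- The `A`-component of a finitely generated projective module is a direct summand of
some `(A × N)ⁿ`. -/
theorem exists_retract_corner (Q : Type u) [AddCommGroup Q] [Module L Q] [Module.Finite L Q]
    [Module.Projective L Q] :
    ∃ (n : ℕ) (ι : D.corner Q →ₗ[A] (Fin n → A × N)) (ρ : (Fin n → A × N) →ₗ[A] D.corner Q),
      ρ ∘ₗ ι = LinearMap.id := by
  obtain ⟨n, ψ, φ, -, -, h⟩ := Module.Finite.exists_comp_eq_id_of_projective L Q
  -- As a left `A`-module, e_A L is the first row A × N. Thus `ι` reads off the first row of the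
  -- coordinates in Lⁿ, and `ρ` recombines it with the generators `ψ (Pi.single j 1)`.
  let ι : D.corner Q →ₗ[A] (Fin n → A × N) :=
    { toFun z j := (D.projA (φ z.1 j), D.projN (φ z.1 j))
      map_add' z z' := by ext j <;> simp
      map_smul' a z := by
        ext j
        · simp [corner_smul_val]
        · simp [corner_smul_val, projN_mul] }
  let ρ : (Fin n → A × N) →ₗ[A] D.corner Q :=
    { toFun v := ∑ j, (⟨D.ofA (v j).1 • ψ (Pi.single j 1), D.ofA_smul_mem _ _⟩ +
        ⟨D.ofN (v j).2 • ψ (Pi.single j 1), D.ofN_smul_mem _ _⟩)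
      map_add' v w := by
        rw [← Finset.sum_add_distrib]
        refine Finset.sum_congr rfl fun j _ => Subtype.ext ?_
        simp only [Pi.add_apply, Prod.fst_add, Prod.snd_add, map_add, add_smul,
          AddSubgroup.coe_add]
        abel
      map_smul' a v := by
        rw [RingHom.id_apply, Finset.smul_sum]
        refine Finset.sum_congr rfl fun j _ => Subtype.ext ?_
        simp [corner_smul_val, smul_smul] }
  refine ⟨n, ι, ρ, LinearMap.ext fun z => Subtype.ext ?_⟩
  have hz : ∑ j, φ z.1 j • ψ (Pi.single j 1) = z.1 := by
    conv_rhs => rw [← LinearMap.id_apply (R := L) z.1, ← h, LinearMap.comp_apply,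
      LinearMap.pi_apply_eq_sum_univ]
    refine Finset.sum_congr rfl fun j _ => ?_
    congr 2
    ext i
    simp [Pi.single_apply, eq_comm]
  change ((∑ j, _ : D.corner Q) : Q) = z.1
  conv_rhs => rw [← D.mem_corner.1 z.2, ← hz, Finset.smul_sum]
  rw [AddSubgroup.val_finsetSum]
  refine Finset.sum_congr rfl fun j _ => ?_
  rw [smul_smul, ofA_mul, one_mul, one_smul, add_smul]
  rfl

/-- The sequence of induced modules. -/
def inducedSeq (P : ModSeq A) : ModSeq L where
  X i := ModuleCat.of L (D.Induced (P.X i))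
  d i := Induced.map D (P.d i)

variable {D} {P : ModSeq A}

/-- The two components of the induced complex are P and M ⊗ P. -/
theorem acyclic_inducedSeq (h : P.Acyclic) (hM : P.TensorAcyclic (ModuleCat.of Aᵐᵒᵖ M)) :
    (D.inducedSeq P).Acyclic := by
  intro i w
  constructor
  · intro hw
    obtain ⟨x, hx⟩ := (h i _).1 (congrArg Induced.fst hw)
    obtain ⟨t, ht⟩ := (hM i _).1 (congrArg Induced.snd hw)
    exact ⟨⟨x, t⟩, Induced.ext hx ht⟩
  · rintro ⟨w, rfl⟩
    exact Induced.ext ((h i).apply_apply_eq_zero w.fst) ((hM i).apply_apply_eq_zero w.snd)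

/-- By adjunction, Hom_L(T_A P, Q) is Hom_A(P, e_A Q). -/
theorem homAcyclic_inducedSeq (h : P.Acyclic) (hM : P.TensorAcyclic (ModuleCat.of Aᵐᵒᵖ M))
    {Q : Type u} [AddCommGroup Q] [Module L Q]
    (hQ : P.HomAcyclic (ModuleCat.of A (D.corner Q))) :
    (D.inducedSeq P).HomAcyclic (ModuleCat.of L Q) := by
  rw [ModSeq.homAcyclic_iff h] at hQ
  rw [ModSeq.homAcyclic_iff (acyclic_inducedSeq h hM)]
  intro i f hf
  obtain ⟨g, hg⟩ := hQ i (D.cornerMap f ∘ₗ Induced.unit D (P.X (i + 1)))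
    (LinearMap.ext fun x => Subtype.ext (by
      have := LinearMap.congr_fun hf (Induced.unit D (P.X i) x).1
      exact (congrArg f (Induced.map_unit (P.d i) x)).symm.trans this))
  refine ⟨Induced.lift g, Induced.hom_ext fun x => ?_⟩
  refine (congrArg (Induced.lift g) (Induced.map_unit (P.d (i + 1)) x)).trans ?_
  rw [Induced.lift_unit]
  exact congrArg Subtype.val (LinearMap.congr_fun hg x)

/-- The test module e_A Q is a retract of (A × N)ⁿ: completeness of P handles A, and `hN` handles N.
-/
theorem isCompleteProjectiveResolution_inducedSeq (hP : P.IsCompleteProjectiveResolution)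
    (hM : P.TensorAcyclic (ModuleCat.of Aᵐᵒᵖ M)) (hN : P.HomAcyclic (ModuleCat.of A N)) :
    (D.inducedSeq P).IsCompleteProjectiveResolution where
  finite i := have := hP.finite i; Induced.finite
  projective i := have := hP.projective i; Induced.projective
  acyclic := acyclic_inducedSeq hP.acyclic hM
  homAcyclic Q _ _ := by
    refine homAcyclic_inducedSeq (Q := Q) hP.acyclic hM ?_
    obtain ⟨n, ι, ρ, h⟩ := D.exists_retract_corner Q
    have hA := hP.homAcyclic (ModuleCat.of A A) (inferInstanceAs (Module.Finite A A))
      (inferInstanceAs (Module.Projective A A))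
    exact ((hA.prod hP.acyclic hN).pi hP.acyclic n).of_retract hP.acyclic ι ρ h

/-- Acyclicity of M ⊗ P makes M ⊗ - commute with taking cocycles. -/
theorem nonempty_induced_ker_equiv (h : P.Acyclic) (hM : P.TensorAcyclic (ModuleCat.of Aᵐᵒᵖ M))
    (i : ℤ) : Nonempty (D.Induced (LinearMap.ker (P.d i)) ≃ₗ[L]
      LinearMap.ker ((D.inducedSeq P).d i)) := by
  obtain ⟨i, rfl⟩ : ∃ j, i = j + 1 + 1 := ⟨i - 2, by ring⟩
  have hb := NCTensor.kerComparison_bijective B M (fun w => (h i).apply_apply_eq_zero w) (h (i + 1))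
    (hM i) (hM (i + 1))
  let f : D.Induced (LinearMap.ker (P.d (i + 1 + 1))) →ₗ[L]
      LinearMap.ker ((D.inducedSeq P).d (i + 1 + 1)) :=
    (Induced.map D (LinearMap.ker (P.d (i + 1 + 1))).subtype).codRestrict _ fun w =>
      Induced.ext w.fst.2 (NCTensor.kerComparison B M (P.d (i + 1 + 1)) w.snd).2
  refine ⟨LinearEquiv.ofBijective f ⟨fun w w' hw => ?_, ?_⟩⟩
  · have hw := congrArg Subtype.val hw
    exact Induced.ext (Subtype.ext (congrArg Induced.fst hw))
      (hb.1 (Subtype.ext (congrArg Induced.snd hw)))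
  · rintro ⟨w, hw⟩
    obtain ⟨t, ht⟩ := hb.2 ⟨w.snd, congrArg Induced.snd hw⟩
    exact ⟨⟨⟨w.fst, congrArg Induced.fst hw⟩, t⟩,
      Subtype.ext (Induced.ext rfl (congrArg Subtype.val ht))⟩

variable {X : Type u} [AddCommGroup X] [Module A X]

theorem isGorensteinProjective_induced (hM : IsTensorCompatible (ModuleCat.of Aᵐᵒᵖ M))
    (hN : IsHomCompatible (ModuleCat.of A N)) (hX : IsGorensteinProjective (ModuleCat.of A X)) :
    IsGorensteinProjective (ModuleCat.of L (D.Induced X)) := by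
  obtain ⟨P, hP, ⟨e⟩⟩ := hX
  obtain ⟨e'⟩ := nonempty_induced_ker_equiv (D := D) hP.acyclic (hM P hP) 0
  exact ⟨D.inducedSeq P, isCompleteProjectiveResolution_inducedSeq hP (hM P hP) (hN P hP),
    ⟨(Induced.congr D e).trans e'⟩⟩

/-- X is a retract of the projective A ⊗_L T_A X, through x ↦ 1 ⊗ (x, 0) and a ⊗ (x, t) ↦ ax. -/
theorem projective_of_projective_induced [Module.Finite A X]
    (h : Module.Projective L (D.Induced X)) : Module.Projective A X := by
  have : Module.Finite L (D.Induced X) := Induced.finite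
  let ι : X →ₗ[A] ScalarExtension D.projA (D.Induced X) :=
    { toFun x := ScalarExtension.unit D.projA (Induced.unit D X x).1
      map_add' x y := by simp
      map_smul' a x := by
        rw [map_smul, corner_smul_val, ScalarExtension.unit_smul, projA_ofA]
        rfl }
  let ρ : ScalarExtension D.projA (D.Induced X) →ₗ[A] X := ScalarExtension.lift
    { toFun w := Inflation.of w.fst
      map_add' w w' := by simp
      map_smul' l w := rfl }
  exact Module.Projective.of_split ι ρ
    (LinearMap.ext fun x => ScalarExtension.lift_unit _ _)

/-- A map out of an induced module is determined on the `A`-component, and here it vanishes there.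
-/
theorem subsingleton_of_surjective_of_corner {Z : Type u} [AddCommGroup Z] [Module L Z]
    (hZ : Subsingleton (D.corner Z)) (f : D.Induced X →ₗ[L] Z) (hf : Function.Surjective f) :
    Subsingleton Z := by
  have hf0 : f = 0 := Induced.hom_ext fun x =>
    congrArg Subtype.val (hZ.elim (D.cornerMap f (Induced.unit D X x)) 0)
  refine ⟨fun z z' => ?_⟩
  obtain ⟨w, rfl⟩ := hf z
  obtain ⟨w', rfl⟩ := hf z'
  simp [hf0]

/-- Induction carries decompositions of X to T_A X, and the corner functor carries them back. No
nonzero summand is lost, since a quotient of an induced module with zero `A`-component is zero. -/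
theorem indecomposable_induced_iff :
    Indecomposable (ModuleCat.of L (D.Induced X)) ↔ Indecomposable (ModuleCat.of A X) := by
  have hs : ∀ (Y : Type u) [AddCommGroup Y] [Module A Y], Subsingleton (D.Induced Y) →
      Subsingleton Y := fun Y _ _ h =>
    ⟨fun y y' => congrArg Induced.fst
      (Subsingleton.elim (Induced.unit D Y y).1 (Induced.unit D Y y').1)⟩
  rw [indecomposable_iff, indecomposable_iff]
  constructor
  · rintro ⟨hX, h⟩
    refine ⟨?_, fun Y Y' _ _ _ _ e => ?_⟩
    · by_contra hX'
      rw [not_nontrivial_iff_subsingleton] at hX'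
      have := subsingleton_of_surjective_of_corner (D := D)
        (Induced.cornerEquiv D X).toEquiv.subsingleton LinearMap.id Function.surjective_id
      exact not_subsingleton _ this
    · exact (h _ _ ((Induced.congr D e).trans (Induced.prodEquiv D Y Y'))).imp (hs Y) (hs Y')
  · rintro ⟨hX, h⟩
    refine ⟨?_, fun Z Z' _ _ _ _ e => ?_⟩
    · by_contra hX'
      rw [not_nontrivial_iff_subsingleton] at hX'
      exact not_subsingleton _ (hs X hX')
    · refine (h _ _ ((Induced.cornerEquiv D X).symm.trans
        ((D.cornerCongr e).trans D.cornerProd))).imp (fun hZ => ?_) fun hZ => ?_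
      · exact subsingleton_of_surjective_of_corner hZ (LinearMap.fst L Z Z' ∘ₗ e.toLinearMap)
          (Prod.fst_surjective.comp e.surjective)
      · exact subsingleton_of_surjective_of_corner hZ (LinearMap.snd L Z Z' ∘ₗ e.toLinearMap)
          (Prod.snd_surjective.comp e.surjective)

theorem isGPFree_of_isGPFree (D : MoritaPresentation L A N M B)
    (hM : IsTensorCompatible (ModuleCat.of Aᵐᵒᵖ M))
    (hN : IsHomCompatible (ModuleCat.of A N)) (h : IsGPFree L) : IsGPFree A := fun G hG => by
  have := IsGorensteinProjective.finite (G := G) hG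
  exact projective_of_projective_induced (D := D)
    (h (ModuleCat.of L (D.Induced G)) (isGorensteinProjective_induced hM hN hG))

/-- G is recovered as the `A`-component of T_A G, so the `A`-components of a finite list over `L`
suffice. -/
theorem isGPFinite_of_isGPFinite (D : MoritaPresentation L A N M B)
    (hM : IsTensorCompatible (ModuleCat.of Aᵐᵒᵖ M))
    (hN : IsHomCompatible (ModuleCat.of A N)) (h : IsGPFinite L) : IsGPFinite A := by
  classical
  obtain ⟨F, hF⟩ := h
  refine ⟨F.image fun Z : ModuleCat.{u} L => ModuleCat.of A (D.corner Z), fun G hG hG' => ?_⟩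
  obtain ⟨Z, hZ, ⟨e⟩⟩ := hF (ModuleCat.of L (D.Induced G))
    (indecomposable_induced_iff.2 hG) (isGorensteinProjective_induced hM hN hG')
  exact ⟨_, Finset.mem_image_of_mem _ hZ, ⟨((Induced.cornerEquiv D G).symm.trans
    (D.cornerCongr e.toLinearEquiv)).toModuleIso⟩⟩

end MoritaPresentation

end Morita

/-! ## Extension of scalars to the diagonal entries -/

section Morita

variable {L A N M B : Type u} [Ring L] [Ring A] [Ring B]
  [AddCommGroup M] [Module B M] [Module Aᵐᵒᵖ M] [SMulCommClass B Aᵐᵒᵖ M]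
  [AddCommGroup N] [Module A N] [Module Bᵐᵒᵖ N] [SMulCommClass A Bᵐᵒᵖ N]

namespace MoritaPresentation

variable (D : MoritaPresentation L A N M B)

section

variable (Z : Type u) [AddCommGroup Z] [Module L Z]

/-- The map `n ⊗ z ↦ n • z`. -/
def actN : NCTensor L (RightInflation D.projB N) Z →ₗ[A] D.corner Z where
  toFun := RightInflation.lift (fun n z => ⟨D.ofN n • z, D.ofN_smul_mem n z⟩)
    (fun n n' z => Subtype.ext (by simp [add_smul]))
    (fun n z z' => Subtype.ext (by simp))
    (fun n l z => Subtype.ext (by simp [smul_smul, ofN_mul]))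
  map_add' := map_add _
  map_smul' a t := by
    rw [RingHom.id_apply]
    induction t using RightInflation.induction with
    | h0 => simp
    | ht n z =>
      refine Subtype.ext ?_
      rw [RightInflation.smul_tmul', RightInflation.lift_tmul, RightInflation.lift_tmul,
        corner_smul_val, smul_smul, ofA_mul_ofN]
    | ha s t hs ht => rw [smul_add, map_add, map_add, hs, ht, smul_add]

@[simp] theorem actN_tmul (n : N) (z : Z) :
    (D.actN Z (RightInflation.tmul D.projB n z)).1 = D.ofN n • z := rfl

/-- The map from the `A`-component of `Z` to `A ⊗_L Z`. -/
def toExt : D.corner Z →ₗ[A] ScalarExtension D.projA Z where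
  toFun z := ScalarExtension.unit D.projA z.1
  map_add' z z' := by simp
  map_smul' a z := by
    rw [corner_smul_val, ScalarExtension.unit_smul, projA_ofA]
    rfl

theorem toExt_apply (z : D.corner Z) : D.toExt Z z = ScalarExtension.unit D.projA z.1 := rfl

variable {Z} {Z' : Type u} [AddCommGroup Z'] [Module L Z']

theorem toExt_ofA_one_smul (z : Z) :
    D.toExt Z ⟨D.ofA 1 • z, D.ofA_smul_mem 1 z⟩ = ScalarExtension.unit D.projA z := by
  rw [toExt_apply, ScalarExtension.unit_smul, projA_ofA, one_smul]

theorem actN_map (f : Z →ₗ[L] Z') (t : NCTensor L (RightInflation D.projB N) Z) :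
    D.actN Z' (NCTensor.map _ f t) = D.cornerMap f (D.actN Z t) := by
  induction t using RightInflation.induction with
  | h0 => simp
  | ht n z => exact Subtype.ext (map_smul f (D.ofN n) z).symm
  | ha s t hs ht => simp only [map_add, hs, ht]

theorem map_toExt (f : Z →ₗ[L] Z') (z : D.corner Z) :
    NCTensor.map (RightInflation D.projA A) f (D.toExt Z z) = D.toExt Z' (D.cornerMap f z) := rfl

theorem toExt_surjective : Function.Surjective (D.toExt Z) := fun t => by
  induction t using ScalarExtension.induction with
  | h0 => exact ⟨0, map_zero _⟩
  | hu a z => exact ⟨a • ⟨D.ofA 1 • z, D.ofA_smul_mem 1 z⟩, by rw [map_smul, toExt_ofA_one_smul]⟩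
  | ha s t hs ht =>
    obtain ⟨s, rfl⟩ := hs
    obtain ⟨t, rfl⟩ := ht
    exact ⟨s + t, map_add _ _ _⟩

/-- Together with `exists_actN_eq` and `toExt_surjective`, exactness of N ⊗_L Z → e_A Z → A ⊗_L Z →
0. -/
theorem toExt_actN (t : NCTensor L (RightInflation D.projB N) Z) : D.toExt Z (D.actN Z t) = 0 := by
  induction t using RightInflation.induction with
  | h0 => simp
  | ht n z =>
    rw [toExt_apply, actN_tmul, ScalarExtension.unit_smul, projA_ofN, zero_smul]
  | ha s t hs ht => rw [map_add, map_add, hs, ht, add_zero]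

/-- The map y ↦ [e_A y] from Z to e_A Z / N Z is `L`-linear, so it factors through A ⊗_L Z; hence an
element that dies there lies in N Z. -/
theorem exists_actN_eq {z : D.corner Z} (hz : D.toExt Z z = 0) : ∃ t, D.actN Z t = z := by
  let f : Z →ₗ[L] Inflation D.projA (D.corner Z ⧸ LinearMap.range (D.actN Z)) :=
    { toFun y := Inflation.of (Submodule.Quotient.mk ⟨D.ofA 1 • y, D.ofA_smul_mem 1 y⟩)
      map_add' y y' := by
        rw [← map_add, ← Submodule.Quotient.mk_add]
        exact congrArg _ (congrArg _ (Subtype.ext (smul_add _ _ _)))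
      map_smul' l y := by
        rw [RingHom.id_apply, Inflation.smul_of, ← Submodule.Quotient.mk_smul]
        -- If l has first row (a, n), then e_A l y - a e_A y = n y, which dies in the quotient.
        refine congrArg _ ((Submodule.Quotient.eq _).2
          ⟨RightInflation.tmul D.projB (D.projN l) y, Subtype.ext ?_⟩)
        simp [corner_smul_val, smul_smul, ofA_mul, add_smul] }
  have h := congrArg (ScalarExtension.lift f) hz
  rw [toExt_apply, ScalarExtension.lift_unit, map_zero] at h
  refine (Submodule.Quotient.mk_eq_zero _).1 (Eq.trans (congrArg _ ?_) h)
  exact Subtype.ext z.2.symm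

/-- For Z = L the map is the inclusion of N as a matrix entry; in general the `N`-entries of the
coordinates in Lⁿ recover the tensor. -/
theorem actN_injective_of_projective [Module.Finite L Z] [Module.Projective L Z] :
    Function.Injective (D.actN Z) := by
  obtain ⟨n, ψ, φ, -, -, h⟩ := Module.Finite.exists_comp_eq_id_of_projective L Z
  have key : ∀ t j, D.projN (φ (D.actN Z t).1 j) =
      NCTensor.toPi A (RightInflation D.projB N) φ t j := fun t j => by
    induction t using RightInflation.induction with
    | h0 => simp; rfl
    | ht n z =>
      rw [actN_tmul, map_smul, Pi.smul_apply, smul_eq_mul, ofN_mul, projN_ofN]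
      rfl
    | ha s t hs ht => simp only [map_add, AddSubgroup.coe_add, Pi.add_apply, hs, ht]; rfl
  rw [injective_iff_map_eq_zero]
  intro t ht
  rw [← LinearMap.id_apply (R := A) t, ← NCTensor.ofPi_toPi A (RightInflation D.projB N) h,
    LinearMap.comp_apply]
  have h0 : NCTensor.toPi A (RightInflation D.projB N) φ t = 0 := funext fun j => by
    rw [← key, ht]
    simp
    rfl
  rw [h0, map_zero]

/-- The section splits 0 → N ⊗_L Z → e_A Z → A ⊗_L Z → 0. -/
theorem bijective_add_actN (h : Function.Injective (D.actN Z))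
    {s : ScalarExtension D.projA Z →ₗ[A] D.corner Z} (hs : D.toExt Z ∘ₗ s = LinearMap.id) :
    Function.Bijective (s.coprod (D.actN Z)) := by
  have hs' : ∀ c, D.toExt Z (s c) = c := LinearMap.congr_fun hs
  constructor
  · rw [injective_iff_map_eq_zero]
    rintro ⟨c, t⟩ hct
    rw [LinearMap.coprod_apply] at hct
    have hc := congrArg (D.toExt Z) hct
    rw [map_add, hs', toExt_actN, add_zero, map_zero] at hc
    change c = 0 at hc
    subst hc
    simp only [map_zero, zero_add] at hct
    rw [(injective_iff_map_eq_zero _).1 h t hct]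
    rfl
  · intro z
    obtain ⟨t, ht⟩ := D.exists_actN_eq (z := z - s (D.toExt Z z))
      (by rw [map_sub, hs', sub_self])
    exact ⟨(D.toExt Z z, t), by rw [LinearMap.coprod_apply, ht, add_sub_cancel]⟩

/-- The difference z - z' lies in N Z, and M N = 0 inside `L`. -/
theorem ofM_smul_eq (m : M) {z z' : D.corner Z} (h : D.toExt Z z = D.toExt Z z') :
    D.ofM m • z.1 = D.ofM m • z'.1 := by
  obtain ⟨t, ht⟩ := D.exists_actN_eq (z := z - z') (by rw [map_sub, h, sub_self])
  rw [← sub_eq_zero, ← smul_sub, ← AddSubgroup.coe_sub, ← ht]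
  clear ht
  induction t using RightInflation.induction with
  | h0 => simp
  | ht n z => simp [smul_smul]
  | ha s t hs ht => rw [map_add, AddSubgroup.coe_add, smul_add, hs, ht, add_zero]

/-- Under M ⊗_A (A ⊗_L Z) ≅ M ⊗_L Z the map becomes the action m ⊗ z ↦ mz, whatever the section:
changing the lift alters it by an element of M N Z = 0. -/
theorem liftSnd_eq {s : ScalarExtension D.projA Z →ₗ[A] D.corner Z}
    (hs : D.toExt Z ∘ₗ s = LinearMap.id) (t : NCTensor A M (ScalarExtension D.projA Z)) :
    Induced.liftSnd s t = (D.swap.actN Z (ScalarExtension.assoc D.projA Z M t)).1 := by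
  obtain ⟨t, rfl⟩ := (ScalarExtension.assoc D.projA Z M).symm.surjective t
  rw [AddEquiv.apply_symm_apply]
  induction t using RightInflation.induction with
  | h0 =>
    rw [map_zero, map_zero]
    exact (congrArg Subtype.val (map_zero (D.swap.actN Z))).symm
  | ht m z =>
    rw [ScalarExtension.assoc_symm_tmul, Induced.liftSnd_tmul]
    refine (D.ofM_smul_eq m (z' := ⟨D.ofA 1 • z, D.ofA_smul_mem 1 z⟩) ?_).trans ?_
    · rw [toExt_ofA_one_smul]
      exact LinearMap.congr_fun hs _
    · rw [smul_smul, ofM_mul_ofA, MulOpposite.op_one, one_smul]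
      rfl
  | ha s t hs ht =>
    rw [map_add, map_add, hs, ht]
    exact (congrArg Subtype.val (map_add (D.swap.actN Z) s t)).symm

/-- The Peirce decomposition Z = e_A Z ⊕ e_B Z. -/
theorem bijective_corner_add : Function.Bijective
    fun p : D.corner Z × D.swap.corner Z => p.1.1 + p.2.1 := by
  have hA : ∀ z : D.corner Z, D.ofB 1 • z.1 = 0 := fun z => by
    rw [← D.mem_corner.1 z.2, smul_smul, ofB_mul_ofA, zero_smul]
  have hB : ∀ z : D.swap.corner Z, D.ofB 1 • z.1 = z.1 := fun z => z.2
  constructor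
  · rintro ⟨x, y⟩ ⟨x', y'⟩ h
    have hy : y = y' := Subtype.ext (by
      simpa [hA, hB] using congrArg (D.ofB 1 • ·) h)
    subst hy
    exact Prod.ext (Subtype.ext (add_right_cancel h)) rfl
  · intro z
    refine ⟨(⟨D.ofA 1 • z, D.ofA_smul_mem 1 z⟩, ⟨D.ofB 1 • z, D.swap.ofA_smul_mem 1 z⟩), ?_⟩
    change D.ofA 1 • z + D.ofB 1 • z = z
    rw [← add_smul, ofA_one_add_ofB_one, one_smul]

/-- If the two component sequences of `Z` split, then `Z` is a sum of induced modules. -/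
theorem nonempty_equiv_induced_prod
    (hN : Function.Injective (D.actN Z)) (hM : Function.Injective (D.swap.actN Z))
    {s : ScalarExtension D.projA Z →ₗ[A] D.corner Z} (hs : D.toExt Z ∘ₗ s = LinearMap.id)
    {s' : ScalarExtension D.swap.projA Z →ₗ[B] D.swap.corner Z}
    (hs' : D.swap.toExt Z ∘ₗ s' = LinearMap.id) :
    Nonempty ((D.Induced (ScalarExtension D.projA Z) ×
      D.swap.Induced (ScalarExtension D.swap.projA Z)) ≃ₗ[L] Z) := by
  refine ⟨LinearEquiv.ofBijective ((Induced.lift s).coprod (Induced.lift s')) ?_⟩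
  -- The four pieces A ⊗ Z, M ⊗ Z, B ⊗ Z, N ⊗ Z are regrouped: the first and last make up e_A Z, the
  -- middle two e_B Z.
  let e : D.Induced (ScalarExtension D.projA Z) ×
      D.swap.Induced (ScalarExtension D.swap.projA Z) ≃
      (ScalarExtension D.projA Z × NCTensor L (RightInflation D.projB N) Z) ×
      (ScalarExtension D.swap.projA Z × NCTensor L (RightInflation D.swap.projB M) Z) :=
    { toFun p := ((p.1.fst, ScalarExtension.assoc D.swap.projA Z N p.2.snd),
        (p.2.fst, ScalarExtension.assoc D.projA Z M p.1.snd))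
      invFun p := (⟨p.1.1, (ScalarExtension.assoc D.projA Z M).symm p.2.2⟩,
        ⟨p.2.1, (ScalarExtension.assoc D.swap.projA Z N).symm p.1.2⟩)
      left_inv p := by simp
      right_inv p := Prod.ext (Prod.ext rfl (AddEquiv.apply_symm_apply _ _))
        (Prod.ext rfl (AddEquiv.apply_symm_apply _ _)) }
  have hb := (D.bijective_corner_add (Z := Z)).comp
    (((D.bijective_add_actN hN hs).prodMap (D.swap.bijective_add_actN hM hs')).comp e.bijective)
  convert hb using 1
  funext p
  have h1 := D.liftSnd_eq hs p.1.snd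
  have h2 := D.swap.liftSnd_eq hs' p.2.snd
  rw [LinearMap.coprod_apply, Induced.lift_apply, Induced.lift_apply, h1, h2]
  change (s p.1.fst).1 + (D.swap.actN Z (ScalarExtension.assoc D.projA Z M p.1.snd)).1 +
      ((s' p.2.fst).1 + (D.actN Z (ScalarExtension.assoc D.swap.projA Z N p.2.snd)).1) =
    (s p.1.fst).1 + (D.actN Z (ScalarExtension.assoc D.swap.projA Z N p.2.snd)).1 +
      ((s' p.2.fst).1 + (D.swap.actN Z (ScalarExtension.assoc D.projA Z M p.1.snd)).1)
  abel

end

end MoritaPresentation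

end Morita

/-! ## Extension of scalars along complete projective resolutions -/

section Scalars

variable {S A : Type u} [Ring S] [Ring A] {φ : S →+* A} {P : ModSeq S}

/-- Inflation commutes with finite powers. -/
def Inflation.piEquiv (φ : S →+* A) (n : ℕ) (X : Type u) [AddCommGroup X] [Module A X] :
    (Fin n → Inflation φ X) ≃ₗ[S] Inflation φ (Fin n → X) where
  toFun v := Inflation.of fun j => Inflation.of.symm (v j)
  invFun v j := Inflation.of (Inflation.of.symm v j)
  map_add' _ _ := rfl
  map_smul' _ _ := rfl
  left_inv _ := rfl
  right_inv _ := rfl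

namespace ModSeq

theorem HomAcyclic.inflation_tensor {C V X : Type u} [Ring C] [AddCommGroup V] [Module Cᵐᵒᵖ V]
    [Module A V] [SMulCommClass A Cᵐᵒᵖ V] [AddCommGroup X] [Module C X] [Module.Finite C X]
    [Module.Projective C X] (h : P.Acyclic)
    (H : P.HomAcyclic (ModuleCat.of S (Inflation φ V))) :
    P.HomAcyclic (ModuleCat.of S (Inflation φ (NCTensor C V X))) := by
  obtain ⟨n, ι, ρ, hρ⟩ := NCTensor.exists_retract (A := C) A V (X := X)
  exact (H.pi h n).of_retract h
    ((Inflation.piEquiv φ n V).symm.toLinearMap ∘ₗ Inflation.map φ ι)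
    (Inflation.map φ ρ ∘ₗ (Inflation.piEquiv φ n V).toLinearMap)
    (LinearMap.ext fun x => LinearMap.congr_fun hρ (Inflation.of.symm x))

theorem nonempty_scalarExtension_ker_equiv (h : P.Acyclic) (h' : (P.scalarExtension φ).Acyclic)
    (i : ℤ) : Nonempty (ScalarExtension φ (LinearMap.ker (P.d i)) ≃ₗ[A]
      LinearMap.ker ((P.scalarExtension φ).d i)) := by
  obtain ⟨i, rfl⟩ : ∃ j, i = j + 1 + 1 := ⟨i - 2, by ring⟩
  exact ⟨LinearEquiv.ofBijective _ (NCTensor.kerComparison_bijective A (RightInflation φ A)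
    (fun w => (h i).apply_apply_eq_zero w) (h (i + 1)) (h' i) (h' (i + 1)))⟩

end ModSeq

end Scalars

section Morita

variable {L A N M B : Type u} [Ring L] [Ring A] [Ring B]
  [AddCommGroup M] [Module B M] [Module Aᵐᵒᵖ M] [SMulCommClass B Aᵐᵒᵖ M]
  [AddCommGroup N] [Module A N] [Module Bᵐᵒᵖ N] [SMulCommClass A Bᵐᵒᵖ N]

namespace MoritaPresentation

/-! ### Descent of complete resolutions to the diagonal entries, and splitting of cocycles. -/

variable (D : MoritaPresentation L A N M B) {P : ModSeq L}

/-- For projective terms, 0 → N ⊗_L P → e_A P → A ⊗_L P → 0 is a short exact sequence of complexes,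
and the first two are acyclic. The proof is the corresponding chase. -/
theorem acyclic_scalarExtension_projA (h : P.Acyclic) (hf : ∀ i, Module.Finite L (P.X i))
    (hp : ∀ i, Module.Projective L (P.X i))
    (hN : P.TensorAcyclic (ModuleCat.of Lᵐᵒᵖ (RightInflation D.projB N))) :
    (P.scalarExtension D.projA).Acyclic := by
  intro i t
  constructor
  · intro ht
    obtain ⟨y, rfl⟩ := D.toExt_surjective t
    obtain ⟨s, hs⟩ := D.exists_actN_eq (z := D.cornerMap (P.d (i + 1)) y) ht
    have := hf (i + 1 + 1 + 1)
    have := hp (i + 1 + 1 + 1)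
    have hs0 : NCTensor.map (RightInflation D.projB N) (P.d (i + 1 + 1)) s = 0 := by
      refine D.actN_injective_of_projective ?_
      rw [actN_map, hs, map_zero]
      exact Subtype.ext ((h (i + 1)).apply_apply_eq_zero y.1)
    -- Acyclicity of N ⊗_L P makes the connecting class `s` a boundary; subtracting the image of
    -- `s'` turns `y` into a cocycle of P.
    obtain ⟨s', rfl⟩ := (hN (i + 1) s).1 hs0
    have hy : P.d (i + 1) (y - D.actN _ s').1 = 0 := by
      have := congrArg Subtype.val (hs.symm.trans (D.actN_map (P.d (i + 1)) s'))
      rw [AddSubgroup.coe_sub, map_sub]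
      exact sub_eq_zero.2 this
    obtain ⟨x, hx⟩ := (h i _).1 hy
    refine ⟨D.toExt _ ⟨D.ofA 1 • x, D.ofA_smul_mem 1 x⟩, ?_⟩
    refine (D.map_toExt (P.d i) _).trans ?_
    have hx' : D.cornerMap (P.d i) ⟨D.ofA 1 • x, D.ofA_smul_mem 1 x⟩ = y - D.actN _ s' :=
      Subtype.ext (by
        rw [cornerMap_val, map_smul, hx]
        exact (y - D.actN _ s').2)
    rw [hx', map_sub, toExt_actN, sub_zero]
  · rintro ⟨t, rfl⟩
    refine (NCTensor.map_comp_apply (P.d (i + 1)) (P.d i) t).symm.trans ?_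
    exact (congrArg (fun f => NCTensor.map (RightInflation D.projA A) f t) (h.d_comp_d i)).trans
      (NCTensor.map_zero_apply (X := P.X i) t)

/-- In 0 → M ⊗_A X → T_A X → X → 0 the middle term is finitely generated projective over `L`, so
Hom(P, -) is acyclic on it; acyclicity on the left then gives it on the right. -/
theorem homAcyclic_inflation_projA (hP : P.IsCompleteProjectiveResolution) {X : Type u}
    [AddCommGroup X] [Module A X] [Module.Finite A X] [Module.Projective A X]
    (H : P.HomAcyclic (ModuleCat.of L (Inflation D.projB (NCTensor A M X)))) :
    P.HomAcyclic (ModuleCat.of L (Inflation D.projA X)) := by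
  let p : D.Induced X →ₗ[L] Inflation D.projA X :=
    { toFun w := Inflation.of w.fst
      map_add' w w' := by simp
      map_smul' l w := rfl }
  let j : Inflation D.projB (NCTensor A M X) →ₗ[L] D.Induced X :=
    { toFun t := ⟨0, Inflation.of.symm t⟩
      map_add' t t' := by ext <;> simp
      map_smul' l t := by ext <;> simp [NCTensor.tmul_zero, Inflation.of_symm_smul] }
  have hp : Function.Surjective p := fun x => ⟨⟨Inflation.of.symm x, 0⟩, rfl⟩
  have hQ := hP.homAcyclic (ModuleCat.of L (D.Induced X)) Induced.finite Induced.projective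
  rw [ModSeq.homAcyclic_iff hP.acyclic] at H hQ ⊢
  intro i f hf
  have := hP.projective (i + 1)
  obtain ⟨g, rfl⟩ := Module.projective_lifting_property p f hp
  obtain ⟨i, rfl⟩ : ∃ k, i = k + 1 := ⟨i - 1, by ring⟩
  have hfst : ∀ x, (g (P.d (i + 1) x)).fst = 0 := fun x =>
    Inflation.of.injective (LinearMap.congr_fun hf x)
  -- The lift `g` of the cocycle need not be a cocycle; θ records its differential, which lies in
  -- the submodule M ⊗_A X, and θ' then corrects `g`.
  let θ : P.X (i + 1) →ₗ[L] Inflation D.projB (NCTensor A M X) :=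
    { toFun x := Inflation.of (g (P.d (i + 1) x)).snd
      map_add' x x' := by simp
      map_smul' l x := by
        rw [map_smul, map_smul, Induced.smul_snd, hfst, NCTensor.tmul_zero, zero_add]
        rfl }
  obtain ⟨θ', hθ'⟩ := H i θ (LinearMap.ext fun x => by
    change Inflation.of (g (P.d (i + 1) (P.d i x))).snd = _
    rw [(hP.acyclic i).apply_apply_eq_zero, map_zero]
    rfl)
  obtain ⟨ψ, hψ⟩ := hQ (i + 1) (g - j ∘ₗ θ') (LinearMap.ext fun x => by
    have h1 : θ' (P.d (i + 1) x) = Inflation.of (g (P.d (i + 1) x)).snd :=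
      LinearMap.congr_fun hθ' x
    have h2 : g (P.d (i + 1) x) = j (θ' (P.d (i + 1) x)) := by
      rw [h1]
      exact Induced.ext (hfst x) rfl
    exact sub_eq_zero.2 h2)
  refine ⟨p ∘ₗ ψ, ?_⟩
  rw [LinearMap.comp_assoc, hψ, LinearMap.comp_sub, ← LinearMap.comp_assoc,
    show p ∘ₗ j = 0 from rfl, LinearMap.zero_comp, sub_zero]

/-- The extensions of scalars of a complete
projective resolution to both diagonal entries are complete projective resolutions, and its
tensor products with the off-diagonal entries are acyclic. -/
structure IsDiagComplete (P : ModSeq L) : Prop where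
  completeA : (P.scalarExtension D.projA).IsCompleteProjectiveResolution
  completeB : (P.scalarExtension D.projB).IsCompleteProjectiveResolution
  tensorM : P.TensorAcyclic (ModuleCat.of Lᵐᵒᵖ (RightInflation D.projA M))
  tensorN : P.TensorAcyclic (ModuleCat.of Lᵐᵒᵖ (RightInflation D.projB N))

variable {D}

theorem IsDiagComplete.swap (h : D.IsDiagComplete P) : D.swap.IsDiagComplete P :=
  ⟨h.completeB, h.completeA, h.tensorN, h.tensorM⟩

theorem isCompleteProjectiveResolution_scalarExtension {C : Type u} [Ring C] {φ : L →+* C}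
    (hP : P.IsCompleteProjectiveResolution) (h : (P.scalarExtension φ).Acyclic)
    (H : ∀ (Q : Type u) [AddCommGroup Q] [Module C Q], Module.Finite C Q → Module.Projective C Q →
      (P.scalarExtension φ).HomAcyclic (ModuleCat.of C Q)) :
    (P.scalarExtension φ).IsCompleteProjectiveResolution where
  finite i :=
    have := hP.finite i
    have := hP.projective i
    inferInstanceAs (Module.Finite C (ScalarExtension φ (P.X i)))
  projective i :=
    have := hP.finite i
    have := hP.projective i
    inferInstanceAs (Module.Projective C (ScalarExtension φ (P.X i)))
  acyclic := h
  homAcyclic Q := H Q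

/-- N ⊗_L P = N ⊗_B (B ⊗_L P) is acyclic, hence so is A ⊗_L P. For a projective X over A, Hom_B(B
⊗_L P, M ⊗_A X) is acyclic since M ⊗_A X is a retract of Mⁿ, and this transfers to Hom_A(A ⊗_L P,
X). -/
theorem isDiagComplete_of_completeB (hP : P.IsCompleteProjectiveResolution)
    (hB : (P.scalarExtension D.projB).IsCompleteProjectiveResolution)
    (hrow : P.TensorAcyclic (ModuleCat.of Lᵐᵒᵖ (RightInflation D.projA M)))
    (hM : (P.scalarExtension D.projB).HomAcyclic (ModuleCat.of B M))
    (hN : (P.scalarExtension D.projB).TensorAcyclic (ModuleCat.of Bᵐᵒᵖ N)) : D.IsDiagComplete P := by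
  have htN := ModSeq.tensorAcyclic_scalarExtension_iff.1 hN
  have hA := D.acyclic_scalarExtension_projA hP.acyclic hP.finite hP.projective htN
  refine ⟨isCompleteProjectiveResolution_scalarExtension hP hA fun Q _ _ _ _ => ?_, hB, hrow, htN⟩
  exact (ModSeq.homAcyclic_scalarExtension_iff hP.acyclic hA).2 (D.homAcyclic_inflation_projA hP
    ((ModSeq.homAcyclic_scalarExtension_iff hP.acyclic hB.acyclic).1
      (ModSeq.HomAcyclic.tensor hB.acyclic hM)))

theorem acyclic_scalarExtension_projB (hP : P.IsCompleteProjectiveResolution)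
    (hrow : P.TensorAcyclic (ModuleCat.of Lᵐᵒᵖ (RightInflation D.projA M))) :
    (P.scalarExtension D.projB).Acyclic :=
  D.swap.acyclic_scalarExtension_projA hP.acyclic hP.finite hP.projective hrow

/-- The row condition gives acyclicity of B ⊗_L P and the column condition its completeness;
compatibility over `B` then handles `A`. -/
theorem isDiagComplete_of_compatible (hM : IsHomCompatible (ModuleCat.of B M))
    (hN : IsTensorCompatible (ModuleCat.of Bᵐᵒᵖ N)) (hP : P.IsCompleteProjectiveResolution)
    (hrow : P.TensorAcyclic (ModuleCat.of Lᵐᵒᵖ (RightInflation D.projA M)))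
    (hcol : P.HomAcyclic (ModuleCat.of L (Inflation D.projA N))) : D.IsDiagComplete P := by
  have hB := acyclic_scalarExtension_projB hP hrow
  have hB' := isCompleteProjectiveResolution_scalarExtension hP hB fun Q _ _ _ _ =>
    (ModSeq.homAcyclic_scalarExtension_iff hP.acyclic hB).2
      (D.swap.homAcyclic_inflation_projA hP (ModSeq.HomAcyclic.inflation_tensor hP.acyclic hcol))
  exact isDiagComplete_of_completeB hP hB' hrow (hM _ hB') (hN _ hB')

/-- Here B ⊗_L P has projective cocycles, so it is contractible and all conditions over `B` are
automatic. -/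
theorem isDiagComplete_of_globalDimension (hB : globalDimension B < ⊤)
    (hP : P.IsCompleteProjectiveResolution)
    (hrow : P.TensorAcyclic (ModuleCat.of Lᵐᵒᵖ (RightInflation D.projA M))) : D.IsDiagComplete P := by
  have hB' := acyclic_scalarExtension_projB hP hrow
  have hf : ∀ i, Module.Finite B ((P.scalarExtension D.projB).X i) := fun i =>
    have := hP.finite i
    have := hP.projective i
    inferInstanceAs (Module.Finite B (ScalarExtension D.projB (P.X i)))
  have hp : ∀ i, Module.Projective B ((P.scalarExtension D.projB).X i) := fun i =>
    have := hP.finite i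
    have := hP.projective i
    inferInstanceAs (Module.Projective B (ScalarExtension D.projB (P.X i)))
  have hk := ModSeq.projective_ker_of_globalDimension hB' hf hp hB
  exact isDiagComplete_of_completeB hP
    ⟨hf, hp, hB', fun Q _ _ => ModSeq.homAcyclic_of_projective_ker (L := Q) hB' hk⟩ hrow
    (ModSeq.homAcyclic_of_projective_ker hB' hk) (ModSeq.tensorAcyclic_of_projective_ker hB' hk _)

/-- Compose two injections N ⊗ Ker d → N ⊗ P → e_A P: the first by acyclicity of N ⊗_L P, the second
by projectivity of the terms. -/
theorem actN_ker_injective (hP : P.IsCompleteProjectiveResolution)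
    (hN : P.TensorAcyclic (ModuleCat.of Lᵐᵒᵖ (RightInflation D.projB N))) (i : ℤ) :
    Function.Injective (D.actN (LinearMap.ker (P.d i))) := by
  obtain ⟨i, rfl⟩ : ∃ j, i = j + 1 + 1 := ⟨i - 2, by ring⟩
  have := hP.finite (i + 1 + 1)
  have := hP.projective (i + 1 + 1)
  have h := (D.actN_injective_of_projective (Z := P.X (i + 1 + 1))).comp
    (NCTensor.map_subtype_ker_injective (RightInflation D.projB N)
      (fun w => (hP.acyclic i).apply_apply_eq_zero w) (hP.acyclic (i + 1)) (hN i))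
  refine Function.Injective.of_comp
    (f := D.cornerMap (LinearMap.ker (P.d (i + 1 + 1))).subtype) ?_
  convert h using 1
  funext t
  exact (D.actN_map (LinearMap.ker (P.d (i + 1 + 1))).subtype t).symm

theorem isGorensteinProjective_scalarExtension_ker {C : Type u} [Ring C] {φ : L →+* C}
    (hP : P.IsCompleteProjectiveResolution)
    (h : (P.scalarExtension φ).IsCompleteProjectiveResolution) :
    IsGorensteinProjective (ModuleCat.of C (ScalarExtension φ (LinearMap.ker (P.d 0)))) :=
  ⟨_, h, ModSeq.nonempty_scalarExtension_ker_equiv hP.acyclic h.acyclic 0⟩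

/-- The decomposition of a cocycle module into induced modules. -/
theorem nonempty_ker_equiv (hN : IsHomCompatible (ModuleCat.of A N))
    (hP : P.IsCompleteProjectiveResolution) (h : D.IsDiagComplete P)
    (hB : Module.Projective B (ScalarExtension D.projB (LinearMap.ker (P.d 0)))) :
    Nonempty ((D.Induced (ScalarExtension D.projA (LinearMap.ker (P.d 0))) ×
      D.swap.Induced (ScalarExtension D.projB (LinearMap.ker (P.d 0)))) ≃ₗ[L]
        LinearMap.ker (P.d 0)) := by
  let Z := LinearMap.ker (P.d 0)
  have hNi : Function.Injective (D.actN Z) := actN_ker_injective hP h.tensorN 0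
  have hMi : Function.Injective (D.swap.actN Z) := actN_ker_injective hP h.swap.tensorN 0
  obtain ⟨s', hs'⟩ := Module.projective_lifting_property (h := hB) (D.swap.toExt Z) LinearMap.id
    D.swap.toExt_surjective
  have hBf := (isGorensteinProjective_scalarExtension_ker hP h.completeB).finite
  obtain ⟨e⟩ := ModSeq.nonempty_scalarExtension_ker_equiv hP.acyclic h.completeA.acyclic 0
  -- Transport along `e` makes the target a cocycle module of A ⊗_L P, as `exists_section` requires.
  let π := e.toLinearMap ∘ₗ D.toExt Z
  have hπ : ∀ t, π (D.actN Z t) = 0 := fun t => by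
    rw [LinearMap.comp_apply, toExt_actN, map_zero]
  let κ : NCTensor L (RightInflation D.projB N) Z →ₗ[A] LinearMap.ker π :=
    (D.actN Z).codRestrict _ hπ
  have hκ : Function.Bijective κ := by
    refine ⟨fun x y hxy => hNi (congrArg Subtype.val hxy), fun z => ?_⟩
    obtain ⟨t, ht⟩ := D.exists_actN_eq (z := z.1) ((LinearEquiv.map_eq_zero_iff e).1 z.2)
    exact ⟨t, Subtype.ext ht⟩
  -- The kernel of π is N ⊗_L Z ≅ N ⊗_B (B ⊗_L Z). As B ⊗_L Z is finitely generated projective, this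
  -- is a retract of some Nⁿ, where Hom-compatibility applies.
  let ε := (LinearEquiv.ofBijective κ hκ).symm.trans
    (ScalarExtension.assocLinear D.projB Z N A).symm
  have hH : (P.scalarExtension D.projA).HomAcyclic (ModuleCat.of A (LinearMap.ker π)) :=
    (ModSeq.HomAcyclic.tensor h.completeA.acyclic (hN _ h.completeA)).of_retract
      h.completeA.acyclic ε.toLinearMap ε.symm.toLinearMap
      (LinearMap.ext fun x => ε.symm_apply_apply x)
  obtain ⟨s, hs⟩ := ModSeq.exists_section h.completeA.acyclic h.completeA.projective 0 π
    (e.surjective.comp D.toExt_surjective) hH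
  exact D.nonempty_equiv_induced_prod hNi hMi (s := s ∘ₗ e.toLinearMap)
    (LinearMap.ext fun c => e.injective (LinearMap.congr_fun hs (e c))) hs'

/-- The ring `L` is GP-free if `A` and `B` are. -/
theorem isGPFree (hN : IsHomCompatible (ModuleCat.of A N))
    (hdiag : ∀ P : ModSeq L, P.IsCompleteProjectiveResolution → D.IsDiagComplete P)
    (hA : IsGPFree A) (hB : IsGPFree B) : IsGPFree L := by
  rintro Z ⟨P, hP, ⟨e⟩⟩
  have h := hdiag P hP
  have hA' := isGorensteinProjective_scalarExtension_ker hP h.completeA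
  have hB' := isGorensteinProjective_scalarExtension_ker hP h.completeB
  have hpA : Module.Projective A (ScalarExtension D.projA _) := hA _ hA'
  have hpB : Module.Projective B (ScalarExtension D.projB _) := hB _ hB'
  obtain ⟨e'⟩ := nonempty_ker_equiv hN hP h hpB
  have h1 : Module.Projective L (D.Induced (ScalarExtension D.projA (LinearMap.ker (P.d 0)))) :=
    Induced.projective
  have h2 : Module.Projective L
      (D.swap.Induced (ScalarExtension D.projB (LinearMap.ker (P.d 0)))) := Induced.projective
  exact Module.Projective.of_equiv (e'.trans e.symm)

/-- The indecomposable Gorenstein-projective modules are induced. -/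
theorem indecomposable_isGorensteinProjective_iff
    (hM : IsCompatibleBimodule B A M) (hN : IsCompatibleBimodule A B N)
    (hdiag : ∀ P : ModSeq L, P.IsCompleteProjectiveResolution → D.IsDiagComplete P)
    (hB : globalDimension B < ⊤) (Z : ModuleCat.{u} L) :
    (Indecomposable Z ∧ IsGorensteinProjective Z) ↔
      (∃ G : ModuleCat.{u} A, Indecomposable G ∧ IsGorensteinProjective G ∧
        Nonempty (Z ≃ₗ[L] D.Induced G)) ∨
      (∃ Q : ModuleCat.{u} B, Indecomposable Q ∧ Module.Finite B Q ∧ Module.Projective B Q ∧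
        Nonempty (Z ≃ₗ[L] D.swap.Induced Q)) := by
  constructor
  · rintro ⟨hZ, P, hP, ⟨e⟩⟩
    have h := hdiag P hP
    have hA' := isGorensteinProjective_scalarExtension_ker hP h.completeA
    have hB' := isGorensteinProjective_scalarExtension_ker hP h.completeB
    -- B ⊗_L Z is a cocycle module of an acyclic complex of finitely generated projectives over a
    -- ring of finite global dimension.
    have hpB : Module.Projective B (ScalarExtension D.projB (LinearMap.ker (P.d 0))) := by
      have := ModSeq.projective_ker_of_globalDimension h.completeB.acyclic h.completeB.finite
        h.completeB.projective hB 0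
      obtain ⟨e⟩ := ModSeq.nonempty_scalarExtension_ker_equiv hP.acyclic h.completeB.acyclic 0
      exact Module.Projective.of_equiv e.symm
    obtain ⟨e'⟩ := nonempty_ker_equiv hN.1 hP h hpB
    have e'' := e.trans e'.symm
    -- Indecomposability kills one of the two induced summands, so Z is the other.
    rcases (indecomposable_iff.1 hZ).2 _ _ e'' with hs | hs
    · right
      let := @Unique.mk' (D.Induced (ScalarExtension D.projA (LinearMap.ker (P.d 0)))) ⟨0⟩ hs
      have f := e''.trans LinearEquiv.uniqueProd
      refine ⟨ModuleCat.of B (ScalarExtension D.projB (LinearMap.ker (P.d 0))),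
        (indecomposable_induced_iff (D := D.swap)).1 (Indecomposable.of_linearEquiv hZ f),
        hB'.finite, hpB, ⟨f⟩⟩
    · left
      let := @Unique.mk' (D.swap.Induced (ScalarExtension D.projB (LinearMap.ker (P.d 0)))) ⟨0⟩ hs
      have f := e''.trans LinearEquiv.prodUnique
      exact ⟨ModuleCat.of A (ScalarExtension D.projA (LinearMap.ker (P.d 0))),
        indecomposable_induced_iff.1 (Indecomposable.of_linearEquiv hZ f), hA', ⟨f⟩⟩
  · rintro (⟨G, hG, hG', ⟨e⟩⟩ | ⟨Q, hQ, hf, hp, ⟨e⟩⟩)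
    · exact ⟨Indecomposable.of_linearEquiv (indecomposable_induced_iff.2 hG) e.symm,
        (isGorensteinProjective_induced hM.2 hN.1 hG').of_equiv e⟩
    · have hQ' : IsGorensteinProjective (ModuleCat.of B Q) := IsGorensteinProjective.of_projective Q
      exact ⟨Indecomposable.of_linearEquiv (indecomposable_induced_iff.2 hQ) e.symm,
        (isGorensteinProjective_induced (D := D.swap) hN.2 hM.1 hQ').of_equiv e⟩

end MoritaPresentation

end Morita

/-! ## The Morita ring -/

namespace MoritaRing

variable {A N M B : Type u} [Ring A] [Ring B]
  [AddCommGroup M] [Module B M] [Module Aᵐᵒᵖ M] [SMulCommClass B Aᵐᵒᵖ M]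
  [AddCommGroup N] [Module A N] [Module Bᵐᵒᵖ N] [SMulCommClass A Bᵐᵒᵖ N]

variable (A N M B) in
/-- The Morita ring presented as itself. -/
def presentation : MoritaPresentation (MoritaRing A N M B) A N M B := ⟨RingEquiv.refl _⟩

/-- The module `(X, M ⊗_A X)` in terms of a presentation. -/
def inducedAEquiv (D : MoritaPresentation (MoritaRing A N M B) A N M B)
    (ha : ∀ l, D.projA l = l.a) (hb : ∀ l, D.projB l = l.b) (hm : ∀ l, D.projM l = l.m)
    (X : ModuleCat.{u} A) : D.Induced X ≃ₗ[MoritaRing A N M B] inducedA (B := B) N M X where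
  toFun w := ((w.fst, w.snd) : X × NCTensor A M X)
  invFun w := ⟨Prod.fst (α := X) (β := NCTensor A M X) w, Prod.snd (α := X) (β := NCTensor A M X) w⟩
  map_add' w w' := rfl
  map_smul' l w := by
    change (D.projA l • w.fst, NCTensor.tmul A (D.projM l) w.fst + D.projB l • w.snd) =
      ((l.a • w.fst + 0, NCTensor.tmul A l.m w.fst + l.b • w.snd) : X × NCTensor A M X)
    rw [ha, hb, hm, add_zero]

/-- The module `(N ⊗_B Y, Y)` in terms of a presentation. -/
def inducedBEquiv (D : MoritaPresentation (MoritaRing A N M B) B M N A)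
    (ha : ∀ l, D.projB l = l.a) (hb : ∀ l, D.projA l = l.b) (hn : ∀ l, D.projM l = l.n)
    (Y : ModuleCat.{u} B) : D.Induced Y ≃ₗ[MoritaRing A N M B] inducedB (A := A) N M Y where
  toFun w := ((w.snd, w.fst) : NCTensor B N Y × Y)
  invFun w := ⟨Prod.snd (α := NCTensor B N Y) (β := Y) w, Prod.fst (α := NCTensor B N Y) (β := Y) w⟩
  map_add' w w' := rfl
  map_smul' l w := by
    change (NCTensor.tmul B (D.projM l) w.fst + D.projB l • w.snd, D.projA l • w.fst) =
      ((l.a • w.snd + NCTensor.tmul B l.n w.fst, 0 + l.b • w.fst) : NCTensor B N Y × Y)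
    rw [ha, hb, hn, zero_add, add_comm]

/-- The column (X, 0) is the inflation of X along `projA`, up to a zero second component. -/
theorem homAcyclic_inflation_of_columnA {P : ModSeq (MoritaRing A N M B)} (h : P.Acyclic)
    {X : ModuleCat.{u} A} (H : P.HomAcyclic (columnA N M X)) :
    P.HomAcyclic (ModuleCat.of _ (Inflation (presentation A N M B).projA X)) := by
  let ι : Inflation (presentation A N M B).projA X →ₗ[MoritaRing A N M B] columnA (B := B) N M X :=
    { toFun x := ((Inflation.of.symm x, 0) : X × PUnit.{u + 1})
      map_add' x y := rfl
      map_smul' l x :=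
        Prod.ext (α := X) (β := PUnit.{u + 1}) (add_zero (l.a • Inflation.of.symm x)).symm rfl }
  let ρ : columnA (B := B) N M X →ₗ[MoritaRing A N M B] Inflation (presentation A N M B).projA X :=
    { toFun w := Inflation.of (Prod.fst (α := X) (β := PUnit.{u + 1}) w)
      map_add' x y := rfl
      map_smul' l w := by
        change Inflation.of (l.a • Prod.fst (α := X) (β := PUnit.{u + 1}) w + 0) = _
        rw [add_zero]
        rfl }
  exact ModSeq.HomAcyclic.of_retract (L' := columnA (B := B) N M X) h H ι ρ rfl

end MoritaRing

end

theorem mainTheorem9 {R A B M N : Type u}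
    [CommRing R] [IsArtinianRing R]
    [Ring A] [Algebra R A] [Module.Finite R A]
    [Ring B] [Algebra R B] [Module.Finite R B]
    [AddCommGroup M] [Module B M] [Module Aᵐᵒᵖ M] [SMulCommClass B Aᵐᵒᵖ M]
    [Module R M] [IsScalarTower R B M] [IsScalarTower R Aᵐᵒᵖ M] [Module.Finite R M]
    [AddCommGroup N] [Module A N] [Module Bᵐᵒᵖ N] [SMulCommClass A Bᵐᵒᵖ N]
    [Module R N] [IsScalarTower R A N] [IsScalarTower R Bᵐᵒᵖ N] [Module.Finite R N]
    (hMN : Subsingleton (NCTensor A M N)) (hNM : Subsingleton (NCTensor B N M))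
    (hM : IsCompatibleBimodule B A M) (hN : IsCompatibleBimodule A B N) :
    -- (1)
    (IsGPFree (MoritaRing A N M B) → IsGPFree A ∧ IsGPFree B) ∧
    (IsTensorCompatible (S := MoritaRing A N M B)
        (MoritaRing.rowA N M (ModuleCat.of Aᵐᵒᵖ M)) →
      IsHomCompatible (S := MoritaRing A N M B)
        (MoritaRing.columnA N M (ModuleCat.of A N)) →
      IsGPFree A → IsGPFree B → IsGPFree (MoritaRing A N M B)) ∧
    -- (2)
    (IsGPFinite (MoritaRing A N M B) → IsGPFinite A ∧ IsGPFinite B) ∧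
    -- (3)
    (IsTensorCompatible (S := MoritaRing A N M B)
        (MoritaRing.rowA N M (ModuleCat.of Aᵐᵒᵖ M)) →
      globalDimension B < ⊤ → projectiveDimension (ModuleCat.of A N) < ⊤ →
      ∀ Z : ModuleCat.{u} (MoritaRing A N M B),
        (Indecomposable Z ∧ IsGorensteinProjective Z) ↔
          (∃ G : ModuleCat.{u} A, Indecomposable G ∧ IsGorensteinProjective G ∧
            Nonempty (Z ≅ MoritaRing.inducedA N M G)) ∨
          (∃ Q : ModuleCat.{u} B, Indecomposable Q ∧ Module.Finite B Q ∧ Module.Projective B Q ∧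
            Nonempty (Z ≅ MoritaRing.inducedB N M Q))) ∧
    -- (4)
    (IsTensorCompatible (S := MoritaRing A N M B)
        (MoritaRing.rowA N M (ModuleCat.of Aᵐᵒᵖ M)) →
      IsHomCompatible (S := MoritaRing A N M B)
        (MoritaRing.columnA N M (ModuleCat.of A N)) →
      globalDimension A < ⊤ → projectiveDimension (ModuleCat.of B M) < ⊤ →
      ∀ Z : ModuleCat.{u} (MoritaRing A N M B),
        (Indecomposable Z ∧ IsGorensteinProjective Z) ↔
          (∃ P : ModuleCat.{u} A, Indecomposable P ∧ Module.Finite A P ∧ Module.Projective A P ∧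
            Nonempty (Z ≅ MoritaRing.inducedA N M P)) ∨
          (∃ E : ModuleCat.{u} B, Indecomposable E ∧ IsGorensteinProjective E ∧
            Nonempty (Z ≅ MoritaRing.inducedB N M E))) := by
  let D := MoritaRing.presentation A N M B
  have hdiag : IsTensorCompatible (S := MoritaRing A N M B)
        (MoritaRing.rowA N M (ModuleCat.of Aᵐᵒᵖ M)) →
      IsHomCompatible (S := MoritaRing A N M B)
        (MoritaRing.columnA N M (ModuleCat.of A N)) →
      ∀ P : ModSeq (MoritaRing A N M B), P.IsCompleteProjectiveResolution → D.IsDiagComplete P :=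
    fun hrow hcol P hP => MoritaPresentation.isDiagComplete_of_compatible hM.1 hN.2 hP (hrow P hP)
      (MoritaRing.homAcyclic_inflation_of_columnA (X := ModuleCat.of A N) hP.acyclic (hcol P hP))
  refine ⟨fun h => ⟨D.isGPFree_of_isGPFree hM.2 hN.1 h, D.swap.isGPFree_of_isGPFree hN.2 hM.1 h⟩,
    fun hrow hcol hA hB => MoritaPresentation.isGPFree hN.1 (hdiag hrow hcol) hA hB,
    fun h => ⟨D.isGPFinite_of_isGPFinite hM.2 hN.1 h,
      D.swap.isGPFinite_of_isGPFinite hN.2 hM.1 h⟩,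
    fun hrow hB _ Z => ?_, fun hrow hcol hA _ Z => ?_⟩
  · let eA := MoritaRing.inducedAEquiv D (fun _ => rfl) (fun _ => rfl) fun _ => rfl
    let eB := MoritaRing.inducedBEquiv D.swap (fun _ => rfl) (fun _ => rfl) fun _ => rfl
    rw [MoritaPresentation.indecomposable_isGorensteinProjective_iff (D := D) hM hN
      (fun P hP => MoritaPresentation.isDiagComplete_of_globalDimension hB hP (hrow P hP)) hB Z]
    exact or_congr
      (exists_congr fun G => and_congr_right fun _ => and_congr_right fun _ =>
        ⟨fun ⟨e⟩ => ⟨(e.trans (eA G)).toModuleIso⟩,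
          fun ⟨e⟩ => ⟨e.toLinearEquiv.trans (eA G).symm⟩⟩)
      (exists_congr fun Q => and_congr_right fun _ => and_congr_right fun _ =>
        and_congr_right fun _ => ⟨fun ⟨e⟩ => ⟨(e.trans (eB Q)).toModuleIso⟩,
          fun ⟨e⟩ => ⟨e.toLinearEquiv.trans (eB Q).symm⟩⟩)
  -- Part (4) applies the classification with `A` and `B` exchanged. The row and column hypotheses
  -- are not symmetric, so completeness on the diagonal comes from `hdiag` instead of finite global
  -- dimension.
  · let eA := MoritaRing.inducedAEquiv D.swap.swap (fun _ => rfl) (fun _ => rfl) fun _ => rfl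
    let eB := MoritaRing.inducedBEquiv D.swap (fun _ => rfl) (fun _ => rfl) fun _ => rfl
    rw [MoritaPresentation.indecomposable_isGorensteinProjective_iff (D := D.swap) hN hM
      (fun P hP => (hdiag hrow hcol P hP).swap) hA Z, or_comm]
    exact or_congr
      (exists_congr fun P => and_congr_right fun _ => and_congr_right fun _ =>
        and_congr_right fun _ => ⟨fun ⟨e⟩ => ⟨(e.trans (eA P)).toModuleIso⟩,
          fun ⟨e⟩ => ⟨e.toLinearEquiv.trans (eA P).symm⟩⟩)
      (exists_congr fun E => and_congr_right fun _ => and_congr_right fun _ =>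
        ⟨fun ⟨e⟩ => ⟨(e.trans (eB E)).toModuleIso⟩,
          fun ⟨e⟩ => ⟨e.toLinearEquiv.trans (eB E).symm⟩⟩)
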